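/- Let $K$ be a quadratic field with nontrivial automorphism $\sigma$ and let $\overline{\mathbb Q}$ be an algebraic closure of $K$. For coprime positive integers $d,m$ and $n=dm$, a noncuspidal $\overline{\mathbb Q}$-point of $X_0(n)$ is an isomorphism class of triples $x=(E,C_d,C_m)$, where $E$ is an elliptic curve over $\overline{\mathbb Q}$ and $C_d,C_m\subset E$ are cyclic subgroups of orders $d$ and $m$; equivalently, of pairs $(E,C)$ with $C=C_d\oplus C_m$ cyclic of order $n$. The Atkin–Lehner involution is $w_d(x)=(\mu(E),\mu(E[d]),\mu(C_m))$, where $\mu$ is an isogeny from $E$ with kernel $C_d$. A noncuspidal rational point of $X_0(n)/w_d$ is a pair $\{x,w_d(x)\}$ stable under $\operatorname{Gal}(\overline{\mathbb Q}/\mathbb Q)$, and an elliptic curve $F$ over $K$ corresponds to this point if $j(F)$ is the $j$-invariant of the elliptic curve of $x$ or of $w_d(x)$. Write $X_0^+(n)=X_0(n)/w_n$. Let $d$ be an odd positive integer and let $E$ be an elliptic curve over $K$ without complex multiplication (over $\overline{\mathbb Q}$). Suppose that $E$ is a $\mathbb Q$-curve of degree $d$, i.e. there is an isogeny $E\to E^\sigma$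 over $\overline{\mathbb Q}$ whose kernel is cyclic of order $d$, and that $E$ has a $4$-isogeny defined over $K$, i.e. there are an elliptic curve $E'$ over $K$ and an isogeny $E\to E'$ defined over $K$ whose kernel is isomorphic to $\mathbb Z/4\mathbb Z$. Then $E$, or an elliptic curve over $K$ that is isogenous to $E$ over $K$, corresponds to a noncuspidal rational point on $X_0^+(4d)$, $X_0^+(16d)$ or $X_0(4d)/w_d$. -/

import Mathlib

namespace QuadQCurve

open WeierstrassCurve

section Isogenies

variable {L : Type*} [Field L] [DecidableEq L]

/-- Let `k` be a subfield of an algebraically closed field `L` of characteristic zero and let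
`W`, `W'` be elliptic curves over `k`, viewed over `L`. A group homomorphism `φ : W(L) → W'(L)`
is an isogeny defined over `k` if it is a rational map with coefficients in `k`: outside a finite
set of points, `φ (x, y) = (a(x, y) / c(x, y), b(x, y) / c(x, y))` for fixed polynomials
`a`, `b`, `c` over `k`. Such a `φ` is nonzero because `W(L)` is infinite and only finitely many
points may be sent to the origin. -/
def IsIsogeny (k : Type*) [Field k] [Algebra k L] {W W' : WeierstrassCurve L}
    (φ : W.toAffine.Point →+ W'.toAffine.Point) : Prop :=
  ∃ a b c : MvPolynomial (Fin 2) k,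
    {P : W.toAffine.Point | ¬ ∃ (x y : L) (h : W.toAffine.Nonsingular x y)
        (u v : L) (h' : W'.toAffine.Nonsingular u v),
        P = .some x y h ∧ φ P = .some u v h' ∧
        MvPolynomial.aeval ![x, y] c ≠ 0 ∧
        u = MvPolynomial.aeval ![x, y] a / MvPolynomial.aeval ![x, y] c ∧
        v = MvPolynomial.aeval ![x, y] b / MvPolynomial.aeval ![x, y] c}.Finite

/-- The kernel of `φ` is cyclic of order `n`. For isogenies in characteristic zero the order of
the kernel is the degree, so these are the cyclic isogenies of degree `n`, or `n`-isogenies. -/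
def HasCyclicKernel {W W' : WeierstrassCurve L}
    (φ : W.toAffine.Point →+ W'.toAffine.Point) (n : ℕ) : Prop :=
  IsAddCyclic φ.ker ∧ Nat.card φ.ker = n

end Isogenies

section OverAField

variable {K : Type*} [Field K] (L : Type*) [Field L] [DecidableEq L] [Algebra K L]

/-- `E` and `F` are isogenous over `K`. -/
def IsogenousOver (E F : WeierstrassCurve K) : Prop :=
  ∃ φ : (E.baseChange L).toAffine.Point →+ (F.baseChange L).toAffine.Point, IsIsogeny K φ

/-- `E` has an `n`-isogeny defined over `K`: there are an elliptic curve `E'` over `K` and an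
isogeny `E → E'` defined over `K` whose kernel is cyclic of order `n`. -/
def HasCyclicIsogeny (E : WeierstrassCurve K) (n : ℕ) : Prop :=
  ∃ E' : WeierstrassCurve K, E'.IsElliptic ∧
    ∃ φ : (E.baseChange L).toAffine.Point →+ (E'.baseChange L).toAffine.Point,
      IsIsogeny K φ ∧ HasCyclicKernel φ n

/-- `E` does not have complex multiplication: every isogeny `E → E` over the algebraic closure
`L` is multiplication by an integer. -/
def IsNonCM (E : WeierstrassCurve K) : Prop :=
  ∀ φ : (E.baseChange L).toAffine.Point →+ (E.baseChange L).toAffine.Point,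
    IsIsogeny L φ → ∃ n : ℤ, ∀ P, φ P = n • P

/-- For a quadratic field `K` with algebraic closure `L`: `E` is a `ℚ`-curve of degree `d`, that
is, with `σ` the nontrivial automorphism of `K`, there is a cyclic isogeny `E → E^σ` of degree
`d` over `L`. -/
def IsQCurveOfDegree [CharZero K] (E : WeierstrassCurve K) (d : ℕ) : Prop :=
  ∃ σ : K ≃ₐ[ℚ] K, σ ≠ 1 ∧
    ∃ μ : (E.baseChange L).toAffine.Point →+
        ((E.map (σ : K →+* K)).baseChange L).toAffine.Point,
      IsIsogeny L μ ∧ HasCyclicKernel μ d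

end OverAField

section ModularCurves

variable {L : Type*} [Field L] [DecidableEq L]

/-- The conjugation homomorphism `W(L) → W^τ(L)`, `(x, y) ↦ (τ x, τ y)`. -/
def conjPoint (τ : L →+* L) (W : WeierstrassCurve L) :
    W.toAffine.Point →+ (W.map τ).toAffine.Point where
  toFun P := match P with
    | .zero => .zero
    | .some x y h =>
        .some (τ x) (τ y) ((Affine.map_nonsingular W.toAffine τ.injective x y).mpr h)
  map_zero' := rfl
  map_add' := by
    rintro (_ | ⟨x₁, y₁, h₁⟩) (_ | ⟨x₂, y₂, h₂⟩)
    any_goals rfl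
    by_cases hxy : x₁ = x₂ ∧ y₁ = W.toAffine.negY x₂ y₂
    · rw [Affine.Point.add_of_Y_eq hxy.left hxy.right,
        Affine.Point.add_of_Y_eq (congr_arg _ hxy.left) <| by rw [hxy.right, Affine.map_negY]]
      rfl
    · simpa only [Affine.Point.add_some hxy, ← Affine.map_addX, ← Affine.map_addY,
        ← Affine.map_slope] using!
        (Affine.Point.add_some fun h ↦
          hxy ⟨τ.injective h.1, τ.injective (Affine.map_negY (W' := W.toAffine) τ .. ▸ h).2⟩).symm

variable (L) in
/-- A pair `(E, C)` of an elliptic curve over `L` and a cyclic subgroup of order `n`. For `L`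
algebraically closed, the `L`-points of `Y₀(n)`, that is, the noncuspidal `L`-points of `X₀(n)`,
are the isomorphism classes of such pairs. -/
structure LevelPair (n : ℕ) where
  curve : WeierstrassCurve L
  isElliptic : curve.IsElliptic
  subgroup : AddSubgroup curve.toAffine.Point
  isCyclic : IsAddCyclic subgroup
  card_eq : Nat.card subgroup = n

attribute [instance] LevelPair.isElliptic

namespace LevelPair

variable {n : ℕ}

/-- `(E, C)` and `(E', C')` are isomorphic, so they define the same point of `Y₀(n)`. -/
def Iso (x y : LevelPair L n) : Prop :=
  ∃ e : x.curve.toAffine.Point ≃+ y.curve.toAffine.Point,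
    IsIsogeny L e.toAddMonoidHom ∧ IsIsogeny L e.symm.toAddMonoidHom ∧
      x.subgroup.map e.toAddMonoidHom = y.subgroup

/-- `conjPoint` is injective. -/
lemma conjPoint_injective (τ : L →+* L) (W : WeierstrassCurve L) :
    Function.Injective (conjPoint τ W) := by
  rintro (_ | ⟨x₁, y₁, h₁⟩) (_ | ⟨x₂, y₂, h₂⟩) h
  · rfl
  · cases h
  · cases h
  · have h' := Affine.Point.some.inj h
    simpa only [Affine.Point.some.injEq] using ⟨τ.injective h'.1, τ.injective h'.2⟩

/-- The Galois conjugate `(E^τ, τ(C))` of `(E, C)`. -/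
def conj (τ : L →+* L) (x : LevelPair L n) : LevelPair L n where
  curve := x.curve.map τ
  isElliptic := inferInstance
  subgroup := x.subgroup.map (conjPoint τ x.curve)
  isCyclic := by
    have := x.isCyclic
    exact isAddCyclic_of_surjective
      (x.subgroup.equivMapOfInjective _ (conjPoint_injective τ x.curve))
      (AddEquiv.surjective _)
  card_eq := (Nat.card_congr
    (x.subgroup.equivMapOfInjective _ (conjPoint_injective τ x.curve)).toEquiv).symm.trans x.card_eq

/-- For `d ∣ n` with `gcd (d, n / d) = 1`: the pair `y` represents the image `w_d(x)` of `x` under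
the Atkin–Lehner involution `w_d`. Writing `x = (E, C)` and `C = C_d ⊕ C_m` with `m = n / d`,
`C_d = C ∩ E[d]`, `C_m = C ∩ E[m]`, this means that there is an isogeny `μ` from `E` to the curve
of `y` with kernel `C_d` such that the subgroup of `y` is `μ(E[d]) + μ(C_m)`. -/
def IsAtkinLehnerImage (d : ℕ) (x y : LevelPair L n) : Prop :=
  ∃ μ : x.curve.toAffine.Point →+ y.curve.toAffine.Point,
    IsIsogeny L μ ∧
    μ.ker = x.subgroup ⊓ AddSubgroup.torsionBy x.curve.toAffine.Point (d : ℤ) ∧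
    y.subgroup =
      (AddSubgroup.torsionBy x.curve.toAffine.Point (d : ℤ)).map μ ⊔
        (x.subgroup ⊓ AddSubgroup.torsionBy x.curve.toAffine.Point ((n / d : ℕ) : ℤ)).map μ

/-- For `L` an algebraic closure of `ℚ`: the image of `x` in `X₀(n)/w_d` is a `ℚ`-rational point,
that is, the orbit `{x, w_d(x)}` is stable under `Gal(L/ℚ)`: every conjugate of `x` is
`x` or `w_d(x)` as a point of `Y₀(n)`. -/
def IsRationalModAtkinLehner [CharZero L] (d : ℕ) (x : LevelPair L n) : Prop :=
  ∀ τ : L ≃ₐ[ℚ] L,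
    (x.conj (τ : L →+* L)).Iso x ∨ x.IsAtkinLehnerImage d (x.conj (τ : L →+* L))

end LevelPair

variable {K : Type*} [Field K] (L) [CharZero L] [Algebra K L]

/-- The elliptic curve `F` corresponds to a (noncuspidal) `ℚ`-rational point of `X₀(n)/w_d`:
there is such a point, the class of `{x, w_d(x)}`, for which `j(F)` is the `j`-invariant of the
curve of `x` or of the curve of `w_d(x)`. -/
def CorrespondsToRationalPoint (F : WeierstrassCurve K) [F.IsElliptic] (n d : ℕ) : Prop :=
  ∃ x : LevelPair L n, x.IsRationalModAtkinLehner d ∧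
    (algebraMap K L F.j = x.curve.j ∨
      ∃ y : LevelPair L n, x.IsAtkinLehnerImage d y ∧ algebraMap K L F.j = y.curve.j)

/-- The same for the curve `X₀⁺(n) = X₀(n)/w_n`. -/
def CorrespondsToRationalPointPlus (F : WeierstrassCurve K) [F.IsElliptic] (n : ℕ) : Prop :=
  CorrespondsToRationalPoint L F n n

end ModularCurves

end QuadQCurve

/-! Let c generate the kernel of the 4-isogeny φ : E → E', so that its conjugate φ^σ has kernel
generated by c^σ. As d is odd, μ : E → E^σ is bijective on 4-torsion, and c^σ = μ(e) with e of order
4. The outcome depends on the order of φ(e).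

If φ(e) = 0, then e generates ker φ, so μ carries ker φ to its conjugate and (E, ker μ ⊕ ker φ)
gives a point of X₀(4d)/w_d (`exists_levelPair_of_map_ker_eq`).

If φ(e) has order m = 2 or m = 4, then φ^σ ∘ μ ∘ [m] kills ker φ, because 2c = 2e in the first case
and 4c = 0 in the second. Hence it equals ψ ∘ φ with ψ : E' → E'^σ of degree m²d. The kernel of ψ is
cyclic: it contains the φ-image of a generator of ker μ, of order d, and φ(Q) with mQ = e, of order
m². So (E', ker ψ) gives a point of X₀⁺(m²d) (`exists_levelPair_of_addOrderOf`).

Rationality comes from the absence of complex multiplication. Comparing degrees gives μ^σ ∘ μ = ±d;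
hence an automorphism trivial on K changes μ at most by a sign, and ker μ^σ = μ(E[d]).

Isogenies being homomorphisms given by rational formulas off a finite set, their theory is developed
through the x-coordinate. In lowest terms x ∘ φ = A(x)/B(x), and counting generic fibres yields
surjectivity and #ker φ = max(deg A, deg B) (`IsIsogeny.surjective_and_card_ker`). Functions
constant on fibres descend, so ψ above is again an isogeny (`IsIsogeny.of_comp`). One half of the
parallelogram law for degrees already forces #E[n] = n² (`card_torsion`). -/

namespace QuadQCurve

open WeierstrassCurve Polynomial Filter

/-! ### Coordinates of points and statements up to finitely many points. -/

section Coordinates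

variable {L : Type*} [Field L] {W : WeierstrassCurve L}

/-- The `x`-coordinate of a point, with value `0` at the origin. -/
def xc : W.toAffine.Point → L
  | .zero => 0
  | .some x _ _ => x

/-- The `y`-coordinate of a point, with value `0` at the origin. -/
def yc : W.toAffine.Point → L
  | .zero => 0
  | .some _ y _ => y

/-- The odd coordinate `2 y + a₁ x + a₃` of a point, with value `0` at the origin. -/
def om : W.toAffine.Point → L
  | .zero => 0
  | .some x y _ => 2 * y + W.a₁ * x + W.a₃

@[simp] lemma xc_some {x y : L} (h : W.toAffine.Nonsingular x y) :
    xc (Affine.Point.some x y h) = x := rfl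

@[simp] lemma yc_some {x y : L} (h : W.toAffine.Nonsingular x y) :
    yc (Affine.Point.some x y h) = y := rfl

@[simp] lemma om_some {x y : L} (h : W.toAffine.Nonsingular x y) :
    om (Affine.Point.some x y h) = 2 * y + W.a₁ * x + W.a₃ := rfl

lemma exists_eq_some {P : W.toAffine.Point} (hP : P ≠ 0) :
    ∃ (h : W.toAffine.Nonsingular (xc P) (yc P)), P = .some (xc P) (yc P) h := by
  match P, hP with
  | .zero, hP => exact absurd rfl hP
  | .some x y h, _ => exact ⟨h, rfl⟩

lemma om_eq {P : W.toAffine.Point} (hP : P ≠ 0) :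
    om P = 2 * yc P + W.a₁ * xc P + W.a₃ := by
  match P, hP with
  | .zero, hP => exact absurd rfl hP
  | .some x y h, _ => rfl

@[simp] lemma xc_neg (P : W.toAffine.Point) : xc (-P) = xc P := by
  match P with
  | .zero => rfl
  | .some x y h => rfl

@[simp] lemma om_neg (P : W.toAffine.Point) : om (-P) = -om P := by
  match P with
  | .zero => exact neg_zero.symm
  | .some x y h =>
    rw [Affine.Point.neg_some, om_some, om_some, Affine.negY]
    ring

lemma eq_or_eq_neg_of_xc_eq {P Q : W.toAffine.Point} (hP : P ≠ 0) (hQ : Q ≠ 0)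
    (h : xc P = xc Q) : P = Q ∨ P = -Q := by
  match P, Q, hP, hQ with
  | .zero, _, hP, _ => exact absurd rfl hP
  | _, .zero, _, hQ => exact absurd rfl hQ
  | .some _ _ _, .some _ _ _, _, _ => exact Affine.Point.X_eq_iff.mp h

lemma om_sq {P : W.toAffine.Point} (hP : P ≠ 0) : om P ^ 2 = W.Ψ₂Sq.eval (xc P) := by
  match P, hP with
  | .zero, hP => exact absurd rfl hP
  | .some x y h, _ =>
    have := (Affine.equation_iff ..).mp h.left
    simp only [om_some, xc_some, Ψ₂Sq, b₂, b₄, b₆]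
    simp
    linear_combination 4 * this

lemma om_eq_zero_iff {P : W.toAffine.Point} : om P = 0 ↔ P = -P := by
  match P with
  | .zero => exact ⟨fun _ => rfl, fun _ => rfl⟩
  | .some x y h =>
    rw [Affine.Point.neg_some, om_some, Affine.Point.some.injEq, Affine.negY]
    constructor
    · intro h; exact ⟨rfl, by linear_combination h⟩
    · rintro ⟨-, h⟩; linear_combination h

lemma Ψ₂Sq_ne_zero' [CharZero L] (W : WeierstrassCurve L) : W.Ψ₂Sq ≠ 0 := by
  intro h
  have := congrArg (fun p => coeff p 3) h
  simp [Ψ₂Sq, coeff_X_pow] at this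

lemma exists_xc_eq [IsAlgClosed L] [W.IsElliptic] (x : L) :
    ∃ P : W.toAffine.Point, P ≠ 0 ∧ xc P = x := by
  obtain ⟨y, hy⟩ := IsAlgClosed.exists_root
    (X ^ 2 + C (W.a₁ * x + W.a₃) * X - C (x ^ 3 + W.a₂ * x ^ 2 + W.a₄ * x + W.a₆) : L[X])
    (by
      have : (X ^ 2 + C (W.a₁ * x + W.a₃) * X
        - C (x ^ 3 + W.a₂ * x ^ 2 + W.a₄ * x + W.a₆) : L[X]).degree = 2 := by
        compute_degree!
      rw [this]; decide)
  have h : W.toAffine.Equation x y := by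
    rw [Affine.equation_iff]
    simp at hy
    linear_combination hy
  exact ⟨.some x y (Affine.equation_iff_nonsingular.mp h), Affine.Point.some_ne_zero _, rfl⟩

lemma finite_xc_fibre (c : L) : (xc ⁻¹' {c} : Set W.toAffine.Point).Finite := by
  by_cases h : ∃ Q : W.toAffine.Point, Q ≠ 0 ∧ xc Q = c
  · obtain ⟨Q, hQ, rfl⟩ := h
    refine (Set.toFinite {0, Q, -Q}).subset fun P hP => ?_
    by_cases hP0 : P = 0
    · simp [hP0]
    · have := eq_or_eq_neg_of_xc_eq hP0 hQ hP
      simp only [Set.mem_insert_iff, Set.mem_singleton_iff]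
      tauto
  · push Not at h
    refine (Set.finite_singleton 0).subset fun P hP => ?_
    by_contra h0
    exact h P h0 hP

/-- Transfers conditions on all but finitely many x to all but finitely many points; generic
statements are handled through the filter `cofinite`. -/
lemma tendsto_xc : Tendsto (xc : W.toAffine.Point → L) cofinite cofinite :=
  Tendsto.cofinite_of_finite_preimage_singleton finite_xc_fibre

lemma eventually_eval_ne_zero {p : L[X]} (hp : p ≠ 0) :
    ∀ᶠ x in cofinite, p.eval x ≠ 0 := by
  rw [eventually_cofinite]
  simpa using! Polynomial.finite_setOfPred_isRoot hp

lemma eventually_ne_zero : ∀ᶠ P : W.toAffine.Point in cofinite, P ≠ 0 := by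
  simp [eventually_cofinite]

lemma tendsto_neg : Tendsto (fun P : W.toAffine.Point => -P) cofinite cofinite :=
  neg_injective.tendsto_cofinite

lemma eventually_om_ne_zero [CharZero L] : ∀ᶠ P : W.toAffine.Point in cofinite, om P ≠ 0 := by
  filter_upwards [tendsto_xc.eventually (eventually_eval_ne_zero (Ψ₂Sq_ne_zero' W)),
    eventually_ne_zero] with P h1 h2 h3
  apply h1
  rw [← om_sq h2, h3]
  ring

variable (W) in
lemma infinite_point [IsAlgClosed L] [W.IsElliptic] : Infinite W.toAffine.Point :=
  have : Infinite L := IsAlgClosed.instInfinite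
  Infinite.of_surjective (xc : W.toAffine.Point → L) fun x =>
    (exists_xc_eq x).imp fun _ h => h.2

/-- A property of cofinitely many points holds for the points over cofinitely many `x`. -/
lemma eventually_forall_xc {p : W.toAffine.Point → Prop} (h : ∀ᶠ P in cofinite, p P) :
    ∀ᶠ x in cofinite, ∀ P : W.toAffine.Point, P ≠ 0 → xc P = x → p P := by
  rw [eventually_cofinite] at h ⊢
  refine (h.image xc).subset fun x hx => ?_
  simp only [Set.mem_ofPred_eq, not_forall] at hx
  obtain ⟨P, -, hPx, hP⟩ := hx
  exact ⟨P, hP, hPx⟩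

end Coordinates

/-! ### The function field of the curve, modulo finite sets of points. -/

section RationalFunctions

variable {L : Type*} [Field L] {W : WeierstrassCurve L}

/-- `f` is a rational function on `W`, up to finitely many points. -/
def IsRat (f : W.toAffine.Point → L) : Prop :=
  ∃ α β γ : L[X], γ ≠ 0 ∧ ∀ᶠ P in cofinite,
    f P = (α.eval (xc P) + β.eval (xc P) * om P) / γ.eval (xc P)

namespace IsRat

variable {f g : W.toAffine.Point → L}

lemma congr (hf : IsRat f) (h : ∀ᶠ P in cofinite, g P = f P) : IsRat g := by
  obtain ⟨α, β, γ, hγ, hf⟩ := hf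
  refine ⟨α, β, γ, hγ, ?_⟩
  filter_upwards [hf, h] with P h1 h2
  rw [h2, h1]

lemma const (c : L) : IsRat fun _ : W.toAffine.Point => c :=
  ⟨C c, 0, 1, one_ne_zero, .of_forall fun P => by simp⟩

protected lemma xc : IsRat (xc : W.toAffine.Point → L) :=
  ⟨X, 0, 1, one_ne_zero, .of_forall fun P => by simp⟩

protected lemma om : IsRat (om : W.toAffine.Point → L) :=
  ⟨0, 1, 1, one_ne_zero, .of_forall fun P => by simp⟩

lemma add (hf : IsRat f) (hg : IsRat g) : IsRat fun P => f P + g P := by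
  obtain ⟨α, β, γ, hγ, hf⟩ := hf
  obtain ⟨α', β', γ', hγ', hg⟩ := hg
  refine ⟨α * γ' + α' * γ, β * γ' + β' * γ, γ * γ', mul_ne_zero hγ hγ', ?_⟩
  filter_upwards [hf, hg, tendsto_xc.eventually (eventually_eval_ne_zero hγ),
    tendsto_xc.eventually (eventually_eval_ne_zero hγ')] with P h1 h2 h3 h4
  rw [h1, h2, div_add_div _ _ h3 h4]
  simp only [eval_add, eval_mul]
  ring

lemma mul (hf : IsRat f) (hg : IsRat g) : IsRat fun P => f P * g P := by
  obtain ⟨α, β, γ, hγ, hf⟩ := hf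
  obtain ⟨α', β', γ', hγ', hg⟩ := hg
  refine ⟨α * α' + β * β' * W.Ψ₂Sq, α * β' + β * α', γ * γ', mul_ne_zero hγ hγ', ?_⟩
  filter_upwards [hf, hg, eventually_ne_zero] with P h1 h2 h3
  rw [h1, h2, div_mul_div_comm]
  simp only [eval_add, eval_mul, ← om_sq h3]
  ring

lemma neg (hf : IsRat f) : IsRat fun P => -f P :=
  ((const (-1)).mul hf).congr (.of_forall fun P => by ring)

lemma sub (hf : IsRat f) (hg : IsRat g) : IsRat fun P => f P - g P :=
  (hf.add hg.neg).congr (.of_forall fun P => by ring)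

lemma pow (hf : IsRat f) (n : ℕ) : IsRat fun P => f P ^ n := by
  induction n with
  | zero => simpa using const 1
  | succ n ih => simpa only [pow_succ] using! ih.mul hf

lemma eval (hf : IsRat f) (p : L[X]) : IsRat fun P => p.eval (f P) := by
  induction p using Polynomial.induction_on' with
  | add p q hp hq => simpa only [eval_add] using! hp.add hq
  | monomial n a => simpa only [eval_monomial] using! (const a).mul (hf.pow n)

/-- The denominator is rationalised by f(-P). The norm α² - β² Ψ₂Sq is generically nonzero because
f(P) and f(-P) are. -/
lemma inv [IsAlgClosed L] [W.IsElliptic] (hf : IsRat f)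
    (h0 : ∀ᶠ P in cofinite, f P ≠ 0) : IsRat fun P => (f P)⁻¹ := by
  obtain ⟨α, β, γ, hγ, hf⟩ := hf
  have := infinite_point W
  have hd : ∀ᶠ P : W.toAffine.Point in cofinite,
      (α ^ 2 - β ^ 2 * W.Ψ₂Sq).eval (xc P) ≠ 0 := by
    filter_upwards [hf, h0, tendsto_neg.eventually hf, tendsto_neg.eventually h0,
      eventually_ne_zero] with P h1 h2 h3 h4 h5 h6
    rw [h1] at h2
    rw [h3, xc_neg, om_neg] at h4
    simp only [eval_sub, eval_mul, eval_pow, ← om_sq h5] at h6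
    apply mul_ne_zero (div_ne_zero_iff.mp h2).1 (div_ne_zero_iff.mp h4).1
    linear_combination h6
  refine ⟨γ * α, -γ * β, α ^ 2 - β ^ 2 * W.Ψ₂Sq, ?_, ?_⟩
  · rintro h
    obtain ⟨P, hP⟩ := hd.exists
    simp [h] at hP
  · filter_upwards [hd, hf, h0, eventually_ne_zero] with P h1 h2 h3 h4
    rw [h2] at h3 ⊢
    obtain ⟨h5, h6⟩ := div_ne_zero_iff.mp h3
    simp only [eval_sub, eval_mul, eval_pow, ← om_sq h4, eval_neg] at h1 ⊢
    rw [inv_div, div_eq_div_iff h5 h1]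
    ring

lemma div [IsAlgClosed L] [W.IsElliptic] (hf : IsRat f) (hg : IsRat g)
    (h0 : ∀ᶠ P in cofinite, g P ≠ 0) : IsRat fun P => f P / g P := by
  simpa only [div_eq_mul_inv] using! hf.mul (hg.inv h0)

protected lemma yc [CharZero L] : IsRat (yc : W.toAffine.Point → L) := by
  refine ((const 2⁻¹).mul ((IsRat.om.sub ((const W.a₁).mul IsRat.xc)).sub (const W.a₃))).congr ?_
  filter_upwards [eventually_ne_zero] with P hP
  rw [om_eq hP]
  field_simp
  ring

lemma aeval (hf : IsRat f) (hg : IsRat g) (p : MvPolynomial (Fin 2) L) :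
    IsRat fun P => MvPolynomial.aeval ![f P, g P] p := by
  induction p using MvPolynomial.induction_on with
  | C a => simpa using! const a
  | add p q hp hq => simpa only [map_add] using! hp.add hq
  | mul_X p i hp =>
    simp only [map_mul, MvPolynomial.aeval_X]
    refine hp.mul ?_
    fin_cases i
    · exact hf
    · exact hg

/-- An even rational function is a rational function of `x`. -/
lemma even_form [IsAlgClosed L] [W.IsElliptic] [CharZero L] (hf : IsRat f)
    (h : ∀ P, f (-P) = f P) :
    ∃ α γ : L[X], γ ≠ 0 ∧ ∀ᶠ P in cofinite, f P = α.eval (xc P) / γ.eval (xc P) := by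
  obtain ⟨α, β, γ, hγ, hf⟩ := hf
  refine ⟨α, γ, hγ, ?_⟩
  filter_upwards [hf, tendsto_neg.eventually hf] with P h1 h2
  rw [h, xc_neg, om_neg] at h2
  have : (2 : L) ≠ 0 := two_ne_zero
  have h3 : 2 * f P = 2 * (α.eval (xc P) / γ.eval (xc P)) := by
    nth_rw 1 [two_mul, h1, h2, ← add_div]
    ring
  exact mul_left_cancel₀ this h3

end IsRat

end RationalFunctions

/-! ### Homomorphisms of abelian groups with finite kernel. -/

section Homs

variable {A B : Type*} [AddCommGroup A] [AddCommGroup B]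

/-- For every a some b has both b and a + b in H, and then a is their difference. -/
lemma eq_top_of_eventually_mem [Infinite A] {H : AddSubgroup A}
    (h : ∀ᶠ a in cofinite, a ∈ H) : H = ⊤ := by
  refine (AddSubgroup.eq_top_iff' H).mpr fun a => ?_
  obtain ⟨b, hb, hab⟩ := (h.and ((add_right_injective a).tendsto_cofinite.eventually h)).exists
  simpa using H.sub_mem hab hb

lemma hom_ext_of_eventually_eq [Infinite A] {f g : A →+ B}
    (h : ∀ᶠ a in cofinite, f a = g a) : f = g := by
  have : f.eqLocus g = ⊤ := eq_top_of_eventually_mem h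
  exact AddMonoidHom.eq_of_eqOn_top fun a _ => by
    have : a ∈ f.eqLocus g := this ▸ AddSubgroup.mem_top a
    exact this

lemma tendsto_of_finite_ker {f : A →+ B} (h : (f.ker : Set A).Finite) :
    Tendsto f cofinite cofinite := by
  refine Tendsto.cofinite_of_finite_preimage_singleton fun b => ?_
  by_cases hb : ∃ a, f a = b
  · obtain ⟨a, rfl⟩ := hb
    refine (h.image (a + ·)).subset fun a' ha' => ⟨a' - a, ?_, by simp⟩
    have : f a' = f a := ha'
    simp [AddMonoidHom.mem_ker, this]
  · refine Set.finite_empty.subset fun a ha => hb ⟨a, ha⟩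

/-- Multiplicativity of degrees: f restricts to a surjection from the kernel of the composite onto
the kernel of g, and this restriction has the same kernel as f. -/
lemma card_ker_comp {C : Type*} [AddCommGroup C] (g : B →+ C) {f : A →+ B}
    (hf : Function.Surjective f) :
    Nat.card (g.comp f).ker = Nat.card f.ker * Nat.card g.ker := by
  have hle : f.ker ≤ (g.comp f).ker := fun a ha => by
    simp only [AddMonoidHom.mem_ker, AddMonoidHom.comp_apply] at ha ⊢
    rw [ha, map_zero]
  let r : (g.comp f).ker →+ g.ker :=
    (f.comp (g.comp f).ker.subtype).codRestrict g.ker fun a => a.2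
  have hr : Function.Surjective r := by
    rintro ⟨b, hb⟩
    obtain ⟨a, rfl⟩ := hf b
    exact ⟨⟨a, hb⟩, rfl⟩
  have hk : Nat.card r.ker = Nat.card f.ker := by
    refine Nat.card_congr
      ⟨fun a => ⟨a.1.1, congrArg Subtype.val a.2⟩, fun a => ⟨⟨a.1, hle a.2⟩, ?_⟩,
        fun _ => rfl, fun _ => rfl⟩
    exact Subtype.ext a.2
  rw [← hk, AddSubgroup.card_eq_card_quotient_mul_card_addSubgroup r.ker, mul_comm,
    Nat.card_congr (QuotientAddGroup.quotientKerEquivOfSurjective r hr).toEquiv]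

end Homs

/-! ### Isogenies in terms of rational functions. -/

section Isogenies

variable {L : Type*} [Field L]

lemma aeval_aeval_X_zero (x y : L) (p : L[X]) :
    MvPolynomial.aeval ![x, y] (Polynomial.aeval (MvPolynomial.X 0 : MvPolynomial (Fin 2) L) p) =
      p.eval x := by
  rw [← Polynomial.aeval_algHom_apply]
  simp [Polynomial.coe_aeval_eq_eval]

variable [DecidableEq L] {W W' W'' : WeierstrassCurve L}

lemma IsIsogeny.of_algebra {k : Type*} [Field k] [Algebra k L]
    {φ : W.toAffine.Point →+ W'.toAffine.Point} (h : IsIsogeny k φ) : IsIsogeny L φ := by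
  obtain ⟨a, b, c, h⟩ := h
  refine ⟨a.map (algebraMap k L), b.map (algebraMap k L), c.map (algebraMap k L), ?_⟩
  simpa only [MvPolynomial.aeval_map_algebraMap] using h

variable [IsAlgClosed L] [CharZero L] [W.IsElliptic]

/-- Replaces bivariate polynomials with a common denominator by normal forms that are stable under
field operations. -/
lemma isIsogeny_iff {φ : W.toAffine.Point →+ W'.toAffine.Point} :
    IsIsogeny L φ ↔ (∀ᶠ P in cofinite, φ P ≠ 0) ∧ IsRat (fun P => xc (φ P)) ∧
      IsRat (fun P => yc (φ P)) := by
  constructor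
  · rintro ⟨a, b, c, h⟩
    have h : ∀ᶠ P in cofinite, ∃ (x y : L) (h : W.toAffine.Nonsingular x y)
        (u v : L) (h' : W'.toAffine.Nonsingular u v),
        P = .some x y h ∧ φ P = .some u v h' ∧
        MvPolynomial.aeval ![x, y] c ≠ 0 ∧
        u = MvPolynomial.aeval ![x, y] a / MvPolynomial.aeval ![x, y] c ∧
        v = MvPolynomial.aeval ![x, y] b / MvPolynomial.aeval ![x, y] c := h
    have hc : ∀ᶠ P : W.toAffine.Point in cofinite,
        MvPolynomial.aeval ![xc P, yc P] c ≠ 0 := by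
      filter_upwards [h]
      rintro P ⟨x, y, h, u, v, h', rfl, -, h1, -, -⟩
      exact h1
    refine ⟨?_, ((IsRat.aeval .xc .yc a).div (IsRat.aeval .xc .yc c) hc).congr ?_,
      ((IsRat.aeval .xc .yc b).div (IsRat.aeval .xc .yc c) hc).congr ?_⟩
    · filter_upwards [h]
      rintro P ⟨x, y, h, u, v, h', -, h1, -⟩
      rw [h1]
      exact Affine.Point.some_ne_zero _
    · filter_upwards [h]
      rintro P ⟨x, y, h, u, v, h', rfl, h1, h2, h3, h4⟩
      rw [h1]
      exact h3
    · filter_upwards [h]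
      rintro P ⟨x, y, h, u, v, h', rfl, h1, h2, h3, h4⟩
      rw [h1]
      exact h4
  · rintro ⟨h0, ⟨α, β, γ, hγ, hx⟩, ⟨α', β', γ', hγ', hy⟩⟩
    let ι : L[X] →ₐ[L] MvPolynomial (Fin 2) L := Polynomial.aeval (MvPolynomial.X 0)
    let ω : MvPolynomial (Fin 2) L := 2 * MvPolynomial.X 1 + MvPolynomial.C W.a₁ *
      MvPolynomial.X 0 + MvPolynomial.C W.a₃
    refine ⟨(ι α + ι β * ω) * ι γ', (ι α' + ι β' * ω) * ι γ, ι γ * ι γ', ?_⟩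
    have key : ∀ᶠ P : W.toAffine.Point in cofinite, P ≠ 0 ∧ φ P ≠ 0 ∧ γ.eval (xc P) ≠ 0 ∧
        γ'.eval (xc P) ≠ 0 ∧
        xc (φ P) = (α.eval (xc P) + β.eval (xc P) * om P) / γ.eval (xc P) ∧
        yc (φ P) = (α'.eval (xc P) + β'.eval (xc P) * om P) / γ'.eval (xc P) := by
      filter_upwards [eventually_ne_zero, h0, tendsto_xc.eventually (eventually_eval_ne_zero hγ),
        tendsto_xc.eventually (eventually_eval_ne_zero hγ'), hx, hy] with P h1 h2 h3 h4 h5 h6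
      exact ⟨h1, h2, h3, h4, h5, h6⟩
    refine Set.Finite.subset key fun P hP hk => hP ?_
    obtain ⟨h1, h2, h3, h4, h5, h6⟩ := hk
    obtain ⟨h7, h8⟩ := exists_eq_some h1
    obtain ⟨h9, h10⟩ := exists_eq_some h2
    have hω : MvPolynomial.aeval ![xc P, yc P] ω = om P := by
      rw [om_eq h1]
      simp [ω]
    refine ⟨_, _, h7, _, _, h9, h8, h10, ?_, ?_, ?_⟩
    · simp only [map_mul, ι, aeval_aeval_X_zero]
      exact mul_ne_zero h3 h4
    · simp only [map_mul, map_add, ι, aeval_aeval_X_zero, hω]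
      rw [h5, mul_div_mul_right _ _ h4]
    · simp only [map_mul, map_add, ι, aeval_aeval_X_zero, hω]
      rw [h6, mul_comm (γ.eval _), mul_div_mul_right _ _ h3]

namespace IsIsogeny

variable {φ : W.toAffine.Point →+ W'.toAffine.Point}

lemma eventually_ne (h : IsIsogeny L φ) : ∀ᶠ P in cofinite, φ P ≠ 0 := (isIsogeny_iff.mp h).1

lemma finite_ker (h : IsIsogeny L φ) : (φ.ker : Set W.toAffine.Point).Finite := by
  have := h.eventually_ne
  rw [eventually_cofinite] at this
  simpa using! this

lemma tendsto (h : IsIsogeny L φ) : Tendsto φ cofinite cofinite :=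
  tendsto_of_finite_ker h.finite_ker

lemma isRat_xc (h : IsIsogeny L φ) : IsRat fun P => xc (φ P) := (isIsogeny_iff.mp h).2.1

lemma isRat_yc (h : IsIsogeny L φ) : IsRat fun P => yc (φ P) := (isIsogeny_iff.mp h).2.2

lemma isRat_om (h : IsIsogeny L φ) : IsRat fun P => om (φ P) := by
  refine (((IsRat.const 2).mul h.isRat_yc).add
    (((IsRat.const W'.a₁).mul h.isRat_xc).add (IsRat.const W'.a₃))).congr ?_
  filter_upwards [h.eventually_ne] with P hP
  rw [om_eq hP, add_assoc]

lemma of_isRat (h0 : ∀ᶠ P in cofinite, φ P ≠ 0) (hx : IsRat fun P => xc (φ P))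
    (hω : IsRat fun P => om (φ P)) : IsIsogeny L φ := by
  refine isIsogeny_iff.mpr ⟨h0, hx, ((IsRat.const 2⁻¹).mul
    ((hω.sub ((IsRat.const W'.a₁).mul hx)).sub (IsRat.const W'.a₃))).congr ?_⟩
  filter_upwards [h0] with P hP
  rw [om_eq hP]
  field_simp
  ring

lemma isRat_comp (h : IsIsogeny L φ) {f : W'.toAffine.Point → L} (hf : IsRat f) :
    IsRat fun P => f (φ P) := by
  obtain ⟨α, β, γ, hγ, hf⟩ := hf
  refine (((h.isRat_xc.eval α).add ((h.isRat_xc.eval β).mul h.isRat_om)).div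
    (h.isRat_xc.eval γ) ?_).congr (h.tendsto.eventually hf)
  exact (tendsto_xc.comp h.tendsto).eventually (eventually_eval_ne_zero hγ)

lemma comp [W'.IsElliptic] {ψ : W'.toAffine.Point →+ W''.toAffine.Point} (hψ : IsIsogeny L ψ)
    (h : IsIsogeny L φ) : IsIsogeny L (ψ.comp φ) :=
  isIsogeny_iff.mpr ⟨h.tendsto.eventually hψ.eventually_ne, h.isRat_comp hψ.isRat_xc,
    h.isRat_comp hψ.isRat_yc⟩

/-- The function x ∘ φ is even, hence rational in x alone; dividing by the gcd makes the fraction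
reduced. -/
lemma exists_xc_form (h : IsIsogeny L φ) : ∃ A B : L[X], IsCoprime A B ∧ B ≠ 0 ∧
    ∀ᶠ P in cofinite, xc (φ P) = A.eval (xc P) / B.eval (xc P) := by
  obtain ⟨α, γ, hγ, hf⟩ := h.isRat_xc.even_form fun P => by rw [map_neg, xc_neg]
  obtain ⟨A, hA⟩ := EuclideanDomain.gcd_dvd_left α γ
  obtain ⟨B, hB⟩ := EuclideanDomain.gcd_dvd_right α γ
  have hg : EuclideanDomain.gcd α γ ≠ 0 := fun h0 =>
    hγ (EuclideanDomain.gcd_eq_zero_iff.mp h0).2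
  have hB0 : B ≠ 0 := fun h0 => hγ (by rw [hB, h0, mul_zero])
  refine ⟨A, B, ?_, hB0, ?_⟩
  · obtain ⟨u, v, huv⟩ : ∃ u v, EuclideanDomain.gcd α γ = α * u + γ * v :=
      ⟨_, _, EuclideanDomain.gcd_eq_gcd_ab α γ⟩
    refine ⟨u, v, mul_left_cancel₀ hg ?_⟩
    calc _ = (EuclideanDomain.gcd α γ * A) * u + (EuclideanDomain.gcd α γ * B) * v := by ring
      _ = _ := by rw [← hA, ← hB, ← huv, mul_one]
  · filter_upwards [hf, tendsto_xc.eventually (eventually_eval_ne_zero hg)] with P h1 h2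
    rw [h1, ← mul_div_mul_left (A.eval _) _ h2, ← eval_mul, ← eval_mul, ← hA, ← hB]

end IsIsogeny

end Isogenies

/-! ### Generic fibres, surjectivity and the degree. -/

section Fibres

variable {L : Type*} [Field L]

lemma eventually_card_roots_sub [IsAlgClosed L] [CharZero L] [DecidableEq L] {A B : L[X]}
    (hAB : IsCoprime A B) (hN : 0 < max A.natDegree B.natDegree) :
    ∀ᶠ c in cofinite, A - C c * B ≠ 0 ∧
      (A - C c * B).natDegree = max A.natDegree B.natDegree ∧
      (A - C c * B).roots.toFinset.card = max A.natDegree B.natDegree := by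
  set N := max A.natDegree B.natDegree with hNdef
  have hlead : C (A.coeff N) - X * C (B.coeff N) ≠ 0 := by
    intro h
    have h0 : A.coeff N = 0 := by simpa using congrArg (fun p => coeff p 0) h
    have h1 : B.coeff N = 0 := by simpa [coeff_C] using congrArg (fun p => coeff p 1) h
    rcases le_total A.natDegree B.natDegree with h2 | h2
    · rw [hNdef, max_eq_right h2] at h1 hN
      rw [coeff_natDegree, leadingCoeff_eq_zero] at h1
      simp [h1] at hN
    · rw [hNdef, max_eq_left h2] at h0 hN
      rw [coeff_natDegree, leadingCoeff_eq_zero] at h0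
      simp [h0] at hN
  have hw : wronskian A B ≠ 0 := by
    intro h
    obtain ⟨h1, h2⟩ := (hAB.wronskian_eq_zero_iff).mp h
    rw [derivative_eq_zero.mp h1,
      derivative_eq_zero.mp h2] at hNdef
    omega
  have hfin : (Set.image (fun z => A.eval z / B.eval z) {z | (wronskian A B).IsRoot z}).Finite :=
    (Polynomial.finite_setOfPred_isRoot hw).image _
  filter_upwards [eventually_eval_ne_zero hlead, hfin.eventually_cofinite_notMem] with c h1 h2
  have hdeg : (A - C c * B).natDegree = N := by
    refine natDegree_eq_of_le_of_coeff_ne_zero ?_ ?_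
    · refine (natDegree_sub_le _ _).trans (max_le (le_max_left _ _) ?_)
      exact (natDegree_C_mul_le _ _).trans (le_max_right _ _)
    · simpa [coeff_C_mul, mul_comm c] using h1
  have h0 : A - C c * B ≠ 0 := fun h => by rw [h, natDegree_zero] at hdeg; omega
  refine ⟨h0, hdeg, ?_⟩
  rw [Multiset.toFinset_card_of_nodup, ← hdeg]
  · exact (splits_iff_card_roots.mp (IsAlgClosed.splits _))
  · rw [Multiset.nodup_iff_count_le_one]
    intro z
    rw [count_roots]
    by_contra! hz
    obtain ⟨h3, h4⟩ := (one_lt_rootMultiplicity_iff_isRoot h0).mp hz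
    have h3 : A.eval z - c * B.eval z = 0 := by simpa using h3
    have h4 : A.derivative.eval z - c * B.derivative.eval z = 0 := by simpa using h4
    refine h2 ⟨z, ?_, ?_⟩
    · simp only [wronskian, Set.mem_ofPred_eq, IsRoot.def, eval_sub, eval_mul]
      linear_combination B.derivative.eval z * h3 - B.eval z * h4
    · have hB : B.eval z ≠ 0 := by
        intro hB
        obtain ⟨u, v, huv⟩ := hAB
        have := congrArg (eval z) huv
        have hA : A.eval z = 0 := by rw [hB] at h3; simpa using h3
        simp [hA, hB] at this
      simp only
      rw [div_eq_iff hB]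
      linear_combination h3

variable [DecidableEq L] {W W' : WeierstrassCurve L}

/-- The points above x(Q) are the coset P₀ + ker φ and its negative, which adds no new
x-coordinates. On the coset x is injective, since two opposite points in it would give Q = -Q. -/
lemma ncard_xc_fibre {φ : W.toAffine.Point →+ W'.toAffine.Point} {Q : W'.toAffine.Point}
    (hQ : om Q ≠ 0) (hφ : ∃ P, φ P = Q) :
    (xc '' {P | φ P ≠ 0 ∧ xc (φ P) = xc Q}).ncard = Nat.card φ.ker := by
  obtain ⟨P₀, hP₀⟩ := hφ
  have hQ0 : Q ≠ 0 := fun h => hQ (om_eq_zero_iff.mpr (by simp [h]))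
  have hQneg : Q ≠ -Q := fun h => hQ (om_eq_zero_iff.mpr h)
  rw [← Nat.card_coe_set_eq]
  symm
  have hmem : ∀ κ : φ.ker, φ (P₀ + κ.1) = Q := fun κ => by
    rw [map_add, hP₀, κ.2, add_zero]
  refine Nat.card_eq_of_bijective
    (fun κ : φ.ker => (⟨xc (P₀ + κ.1), P₀ + κ.1, ⟨by rw [hmem]; exact hQ0, by rw [hmem]⟩, rfl⟩ :
      xc '' {P | φ P ≠ 0 ∧ xc (φ P) = xc Q})) ⟨?_, ?_⟩
  · intro κ κ' h
    have h : xc (P₀ + κ.1) = xc (P₀ + κ'.1) := congrArg Subtype.val h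
    have hne : ∀ κ : φ.ker, P₀ + κ.1 ≠ 0 := fun κ h => hQ0 (by rw [← hmem κ, h, map_zero])
    rcases eq_or_eq_neg_of_xc_eq (hne κ) (hne κ') h with h | h
    · exact Subtype.ext (add_left_cancel h)
    · refine absurd ?_ hQneg
      nth_rw 1 [← hmem κ]
      rw [h, map_neg, hmem]
  · rintro ⟨_, P, ⟨hP0, hP⟩, rfl⟩
    rcases eq_or_eq_neg_of_xc_eq hP0 hQ0 hP with h | h
    · exact ⟨⟨P - P₀, by simp [AddMonoidHom.mem_ker, h, hP₀]⟩, Subtype.ext (by simp)⟩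
    · exact ⟨⟨-P - P₀, by simp [AddMonoidHom.mem_ker, h, hP₀]⟩, Subtype.ext (by simp)⟩

variable [IsAlgClosed L] [CharZero L] [W.IsElliptic] [W'.IsElliptic]

/-- For generic c the roots of A - cB are exactly the x-coordinates of the points whose image has
x-coordinate c. So the range contains almost all points, hence all, and the size of a fibre is the
number of roots. -/
lemma IsIsogeny.surjective_and_card_ker {φ : W.toAffine.Point →+ W'.toAffine.Point}
    (h : IsIsogeny L φ) {A B : L[X]} (hAB : IsCoprime A B) (hB : B ≠ 0)
    (hx : ∀ᶠ P in cofinite, xc (φ P) = A.eval (xc P) / B.eval (xc P)) :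
    Function.Surjective φ ∧ Nat.card φ.ker = max A.natDegree B.natDegree := by
  have := infinite_point W
  have := infinite_point W'
  have hinf : Infinite L := IsAlgClosed.instInfinite
  have hN : 0 < max A.natDegree B.natDegree := by
    by_contra! hN
    obtain ⟨a, ha⟩ := natDegree_eq_zero.mp (Nat.le_zero.mp ((le_max_left _ _).trans hN))
    obtain ⟨b, hb⟩ := natDegree_eq_zero.mp (Nat.le_zero.mp ((le_max_right _ _).trans hN))
    have hev : ∀ᶠ P in cofinite, xc (φ P) ≠ a / b :=
      (tendsto_xc.comp h.tendsto).eventually (Set.finite_singleton _).eventually_cofinite_notMem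
    obtain ⟨P, h1, h2⟩ := (hx.and hev).exists
    apply h2
    simpa [← ha, ← hb] using h1
  have hgood : ∀ᶠ P in cofinite, φ P ≠ 0 ∧ xc (φ P) = A.eval (xc P) / B.eval (xc P) ∧
      B.eval (xc P) ≠ 0 := h.eventually_ne.and
    (hx.and (tendsto_xc.eventually (eventually_eval_ne_zero hB)))
  have hroot : ∀ᶠ c in cofinite, ∀ x : L, x ∈ (A - C c * B).roots.toFinset ↔
      x ∈ xc '' {P | φ P ≠ 0 ∧ xc (φ P) = c} := by
    have hgx := eventually_forall_xc hgood
    rw [eventually_cofinite] at hgx hgood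
    filter_upwards [eventually_card_roots_sub hAB hN,
      (hgx.image fun x => A.eval x / B.eval x).eventually_cofinite_notMem,
      (hgood.image fun P => xc (φ P)).eventually_cofinite_notMem] with c hc hc1 hc2 x
    rw [Multiset.mem_toFinset, mem_roots hc.1]
    constructor
    · intro hr
      have hr : A.eval x - c * B.eval x = 0 := by simpa using hr
      have hBx : B.eval x ≠ 0 := by
        intro hB
        obtain ⟨u, v, huv⟩ := hAB
        have := congrArg (Polynomial.eval x) huv
        have hA : A.eval x = 0 := by rw [hB] at hr; simpa using hr
        simp [hA, hB] at this
      have hcx : A.eval x / B.eval x = c := by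
        rw [div_eq_iff hBx]
        linear_combination hr
      have hxg : ∀ P : W.toAffine.Point, P ≠ 0 → xc P = x → φ P ≠ 0 ∧
          xc (φ P) = A.eval (xc P) / B.eval (xc P) ∧ B.eval (xc P) ≠ 0 := by
        by_contra hcon
        exact hc1 ⟨x, hcon, hcx⟩
      obtain ⟨P, hP0, rfl⟩ := exists_xc_eq (W := W) x
      obtain ⟨h1, h2, -⟩ := hxg P hP0 rfl
      exact ⟨P, ⟨h1, h2.trans hcx⟩, rfl⟩
    · rintro ⟨P, ⟨hP0, hP⟩, rfl⟩
      have hg : φ P ≠ 0 ∧ xc (φ P) = A.eval (xc P) / B.eval (xc P) ∧ B.eval (xc P) ≠ 0 := by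
        by_contra hcon
        exact hc2 ⟨P, hcon, hP⟩
      rw [hg.2.1, div_eq_iff hg.2.2] at hP
      simp [hP]
  have hsurj : Function.Surjective φ := by
    rw [← AddMonoidHom.range_eq_top]
    refine eq_top_of_eventually_mem ?_
    filter_upwards [tendsto_xc.eventually hroot, eventually_ne_zero,
      tendsto_xc.eventually (eventually_card_roots_sub hAB hN)] with Q hQ hQ0 hcard
    have : (A - C (xc Q) * B).roots.toFinset.Nonempty := by
      rw [← Finset.card_pos, hcard.2.2]
      exact hN
    obtain ⟨x, hx⟩ := this
    obtain ⟨P, ⟨hP0, hP⟩, -⟩ := (hQ x).mp hx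
    rcases eq_or_eq_neg_of_xc_eq hP0 hQ0 hP with h | h
    · exact ⟨P, h⟩
    · exact ⟨-P, by rw [map_neg, h, neg_neg]⟩
  refine ⟨hsurj, ?_⟩
  obtain ⟨Q, hQ, hω, hcard⟩ := ((tendsto_xc (W := W').eventually hroot).and
    (eventually_om_ne_zero.and
      (tendsto_xc.eventually (eventually_card_roots_sub hAB hN)))).exists
  rw [← ncard_xc_fibre hω (hsurj Q), ← hcard.2.2, ← Set.ncard_coe_finset]
  congr 1
  ext x
  exact (hQ x).symm

lemma IsIsogeny.surjective {φ : W.toAffine.Point →+ W'.toAffine.Point}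
    (h : IsIsogeny L φ) : Function.Surjective φ := by
  obtain ⟨A, B, hAB, hB, hx⟩ := h.exists_xc_form
  exact (h.surjective_and_card_ker hAB hB hx).1

end Fibres

/-! ### Descent of functions along an isogeny. -/

section Descent

variable {L : Type*} [Field L]

lemma eval_right_ne_zero {A B : L[X]} (hAB : IsCoprime A B) {c x : L}
    (h : (A - C c * B).eval x = 0) : B.eval x ≠ 0 := by
  intro hB
  obtain ⟨u, v, huv⟩ := hAB
  have hA : A.eval x = 0 := by simpa [hB] using h
  simpa [hA, hB] using congrArg (eval x) huv

lemma eval_sub_C_mul_eq_zero_iff {A B : L[X]} {c x : L} (hB : B.eval x ≠ 0) :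
    (A - C c * B).eval x = 0 ↔ A.eval x / B.eval x = c := by
  rw [div_eq_iff hB, eval_sub, eval_mul, eval_C, sub_eq_zero]

lemma tendsto_eval_div [IsAlgClosed L] [CharZero L] {A B : L[X]} (hAB : IsCoprime A B)
    (hB : B ≠ 0) (hN : 0 < max A.natDegree B.natDegree) :
    Tendsto (fun x => A.eval x / B.eval x) cofinite cofinite := by
  refine Tendsto.cofinite_of_finite_preimage_singleton fun c => ?_
  have hne : A - C c * B ≠ 0 := by
    intro h
    have hA : A = C c * B := sub_eq_zero.mp h
    have hu : IsUnit B := hAB.isUnit_of_dvd' (hA ▸ dvd_mul_left _ _) dvd_rfl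
    have hBd := natDegree_eq_zero_of_isUnit hu
    have hAd : A.natDegree = 0 := by
      rw [hA]
      exact Nat.le_zero.mp ((natDegree_C_mul_le _ _).trans hBd.le)
    omega
  refine ((finite_setOfPred_isRoot hne).union (finite_setOfPred_isRoot hB)).subset fun x hx => ?_
  by_cases hBx : B.eval x = 0
  · exact Or.inr hBx
  · exact Or.inl ((eval_sub_C_mul_eq_zero_iff hBx).mpr hx)

/-- A rational function `T / S` that is constant on the fibres of `A / B` is a rational function
of `A / B`. -/
lemma exists_eval_div_of_degree_lt [IsAlgClosed L] [CharZero L] {A B S T : L[X]}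
    (hAB : IsCoprime A B) (hB : B ≠ 0) (hS : S ≠ 0) (hdeg : B.degree < A.degree)
    {Z : Set L} (hZ : Z.Finite)
    (hconst : ∀ x₁ ∉ Z, ∀ x₂ ∉ Z, A.eval x₁ / B.eval x₁ = A.eval x₂ / B.eval x₂ →
      T.eval x₁ / S.eval x₁ = T.eval x₂ / S.eval x₂) :
    ∃ G H : L[X], H ≠ 0 ∧ ∀ᶠ x in cofinite, T.eval x / S.eval x =
      G.eval (A.eval x / B.eval x) / H.eval (A.eval x / B.eval x) := by
  classical
  have : Infinite L := IsAlgClosed.instInfinite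
  have hA0 : A ≠ 0 := by rintro rfl; simp at hdeg
  have hndeg : B.natDegree < A.natDegree :=
    (natDegree_lt_natDegree_iff hB).mpr hdeg
  have hmax : max A.natDegree B.natDegree = A.natDegree := max_eq_left hndeg.le
  have hN : 0 < max A.natDegree B.natDegree := by omega
  have ha : A.leadingCoeff⁻¹ ≠ 0 := inv_ne_zero (leadingCoeff_ne_zero.mpr hA0)
  set a := A.leadingCoeff⁻¹ with hadef
  -- The outer variable is x and the inner one is the value c of A / B. The polynomial specialises
  -- to a multiple of A - cB, and the factor a makes it monic in x.
  let p : L[X][X] := (C a * A).map C - C X * (C a * B).map C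
  have hmonA : (C a * A).Monic := by
    rw [Monic, leadingCoeff_mul, leadingCoeff_C, hadef,
      inv_mul_cancel₀ (leadingCoeff_ne_zero.mpr hA0)]
  have hpdeg : (C X * (C a * B).map C : L[X][X]).degree < ((C a * A).map C : L[X][X]).degree := by
    rw [degree_C_mul X_ne_zero, degree_map_eq_of_injective C_injective,
      degree_map_eq_of_injective C_injective,
      degree_C_mul ha, degree_C_mul ha]
    exact hdeg
  have hp : p.Monic := (hmonA.map C).sub_of_left hpdeg
  have hpnat : p.natDegree = A.natDegree := by
    rw [natDegree_sub_eq_left_of_natDegree_lt, natDegree_map_eq_of_injective C_injective,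
      natDegree_C_mul ha]
    rw [natDegree_C_mul X_ne_zero, natDegree_map_eq_of_injective C_injective,
      natDegree_map_eq_of_injective C_injective, natDegree_C_mul ha, natDegree_C_mul ha]
    exact hndeg
  have hev : ∀ c : L, p.map (evalRingHom c) = C a * (A - C c * B) := by
    intro c
    have hid : (evalRingHom c).comp (C : L →+* L[X]) = RingHom.id L := by ext; simp
    simp only [p, Polynomial.map_sub, Polynomial.map_mul, Polynomial.map_map, hid, map_C,
      Polynomial.map_id, coe_evalRingHom, eval_X, eval_C]
    ring
  -- The remainder of q modulo p has degree in x below deg A, and agrees with q at the roots of A -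
  -- cB.
  let red : L[X] → L[X][X] := fun q => q.map C %ₘ p
  have hred : ∀ (q : L[X]) (c x : L), (A - C c * B).eval x = 0 →
      ((red q).map (evalRingHom c)).eval x = q.eval x := by
    intro q c x hx
    have hid : (evalRingHom c).comp (C : L →+* L[X]) = RingHom.id L := by ext; simp
    have h1 := congrArg (fun r => (r.map (evalRingHom c)).eval x)
      (modByMonic_add_div (q.map C) p)
    simpa [Polynomial.map_map, hid, hev, hx, red] using h1
  have hreddeg : ∀ (q : L[X]) (c : L),
      ((red q).map (evalRingHom c)).natDegree < A.natDegree := by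
    intro q c
    refine (natDegree_map_le).trans_lt ?_
    rw [← hpnat]
    refine natDegree_modByMonic_lt _ hp ?_
    rintro h
    rw [h, natDegree_one] at hpnat
    omega
  have htend := tendsto_eval_div hAB hB hN
  have hSred : red S ≠ 0 := by
    intro h
    obtain ⟨x, hx1, hx2⟩ := ((eventually_eval_ne_zero hB).and (eventually_eval_ne_zero hS)).exists
    have := hred S _ x ((eval_sub_C_mul_eq_zero_iff hx1).mpr rfl)
    rw [h] at this
    exact hx2 (by simpa using this.symm)
  obtain ⟨i, hi⟩ : ∃ i, (red S).coeff i ≠ 0 := by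
    by_contra! h
    exact hSred (Polynomial.ext (by simpa using h))
  refine ⟨(red T).coeff i, (red S).coeff i, hi, ?_⟩
  have hZ' : (Z ∪ {x | S.IsRoot x}).Finite := hZ.union (finite_setOfPred_isRoot hS)
  filter_upwards [hZ'.eventually_cofinite_notMem, eventually_eval_ne_zero hB,
    htend.eventually (hZ'.image fun x => A.eval x / B.eval x).eventually_cofinite_notMem,
    htend.eventually (eventually_card_roots_sub hAB hN),
    htend.eventually (eventually_eval_ne_zero hi)] with x₀ h0 hB0 h1 h2 h3
  set c := A.eval x₀ / B.eval x₀ with hc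
  set t := T.eval x₀ / S.eval x₀ with ht
  rw [eq_div_iff h3]
  -- The remainders of T and of tS have degree below deg A and agree at deg A distinct roots, so
  -- they coincide. Comparing one coefficient then expresses t through c.
  have hzero : (red T).map (evalRingHom c) - C t * (red S).map (evalRingHom c) = 0 := by
    refine eq_zero_of_natDegree_lt_card_of_eval_eq_zero' _ (A - C c * B).roots.toFinset ?_ ?_
    · intro x hx
      rw [Multiset.mem_toFinset, mem_roots h2.1] at hx
      have hx : (A - C c * B).eval x = 0 := hx
      have hBx := eval_right_ne_zero hAB hx
      have hcx := (eval_sub_C_mul_eq_zero_iff hBx).mp hx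
      have hxZ : x ∉ Z ∪ {x | S.IsRoot x} := fun hmem => h1 ⟨x, hmem, hcx⟩
      have hSx : S.eval x ≠ 0 := fun h => hxZ (Or.inr h)
      have := hconst x (fun h => hxZ (Or.inl h)) x₀ (fun h => h0 (Or.inl h)) (hcx.trans hc)
      rw [eval_sub, eval_mul, eval_C, hred T c x hx, hred S c x hx, ht, ← this,
        div_mul_cancel₀ _ hSx, sub_self]
    · rw [h2.2.2, hmax]
      refine (natDegree_sub_le _ _).trans_lt (max_lt (hreddeg T c) ?_)
      exact (natDegree_C_mul_le _ _).trans_lt (hreddeg S c)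
  have := congrArg (fun q => coeff q i) hzero
  simp only [coeff_sub, coeff_C_mul, coeff_map, coeff_zero, coe_evalRingHom, sub_eq_zero] at this
  exact this.symm

/-- Inversion is absorbed by reversing coefficients; the two powers of u - c₀ that arise are cleared
by cross-multiplication. -/
lemma exists_eval_inv_sub [Infinite L] (G H : L[X]) (hH : H ≠ 0) (c₀ : L) :
    ∃ G' H' : L[X], H' ≠ 0 ∧ ∀ u, u ≠ c₀ →
      G.eval (u - c₀)⁻¹ / H.eval (u - c₀)⁻¹ = G'.eval u / H'.eval u := by
  have key : ∀ (p : L[X]) (v : L), v ≠ 0 → p.eval v⁻¹ = p.reverse.eval v / v ^ p.natDegree := by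
    intro p v hv
    have hv' : v⁻¹ ≠ 0 := inv_ne_zero hv
    let := invertibleOfNonzero hv'
    have := eval₂_reverse_mul_pow (RingHom.id L) v⁻¹ p
    rw [invOf_eq_inv, inv_inv] at this
    change p.reverse.eval v * _ = p.eval _ at this
    rw [← this, inv_pow, div_eq_mul_inv]
  refine ⟨(G.reverse * X ^ H.natDegree).comp (X - C c₀),
    (H.reverse * X ^ G.natDegree).comp (X - C c₀), ?_, ?_⟩
  · intro h
    have h2 : (H.reverse * X ^ G.natDegree) ≠ 0 :=
      mul_ne_zero (by simpa using hH) (pow_ne_zero _ X_ne_zero)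
    obtain ⟨x, hx⟩ := (eventually_eval_ne_zero h2).exists
    apply hx
    simpa using congrArg (eval (x + c₀)) h
  · intro u hu
    have hv : u - c₀ ≠ 0 := sub_ne_zero.mpr hu
    rw [key G _ hv, key H _ hv]
    simp only [eval_comp, eval_mul, eval_sub, eval_X, eval_C, eval_pow]
    rw [div_div_div_eq]
    congr 1
    ring

/-- If deg A ≤ deg B, the Möbius change u ↦ 1/(u - c₀) replaces A/B by B/(A - c₀B). Taking for c₀
the ratio of the coefficients in degree deg B makes the new denominator of smaller degree than B. -/
lemma exists_eval_div [IsAlgClosed L] [CharZero L] {A B S T : L[X]}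
    (hAB : IsCoprime A B) (hB : B ≠ 0) (hS : S ≠ 0) (hN : 0 < max A.natDegree B.natDegree)
    {Z : Set L} (hZ : Z.Finite)
    (hconst : ∀ x₁ ∉ Z, ∀ x₂ ∉ Z, A.eval x₁ / B.eval x₁ = A.eval x₂ / B.eval x₂ →
      T.eval x₁ / S.eval x₁ = T.eval x₂ / S.eval x₂) :
    ∃ G H : L[X], H ≠ 0 ∧ ∀ᶠ x in cofinite, T.eval x / S.eval x =
      G.eval (A.eval x / B.eval x) / H.eval (A.eval x / B.eval x) := by
  have : Infinite L := IsAlgClosed.instInfinite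
  rcases lt_or_ge B.degree A.degree with hdeg | hdeg
  · exact exists_eval_div_of_degree_lt hAB hB hS hdeg hZ hconst
  have hndeg : A.natDegree ≤ B.natDegree := natDegree_le_natDegree hdeg
  rw [max_eq_right hndeg] at hN
  set c₀ := A.coeff B.natDegree / B.leadingCoeff with hc₀
  set A₁ := A - C c₀ * B with hA₁
  have hlt : A₁.degree < B.degree := by
    rw [degree_eq_natDegree hB, degree_lt_iff_coeff_zero]
    intro m hm
    rcases hm.eq_or_lt with rfl | hm
    · rw [hA₁, coeff_sub, coeff_C_mul, hc₀, coeff_natDegree,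
        div_mul_cancel₀ _ (leadingCoeff_ne_zero.mpr hB), sub_self]
    · rw [hA₁, coeff_sub, coeff_C_mul, coeff_eq_zero_of_natDegree_lt hm,
        coeff_eq_zero_of_natDegree_lt (hndeg.trans_lt hm), mul_zero, sub_self]
  have hA₁0 : A₁ ≠ 0 := by
    intro h
    have hA : A = C c₀ * B := sub_eq_zero.mp h
    have hu : IsUnit B := hAB.isUnit_of_dvd' (hA ▸ dvd_mul_left _ _) dvd_rfl
    have := natDegree_eq_zero_of_isUnit hu
    omega
  have hcop : IsCoprime B A₁ := by
    have h : A₁ = A + B * -C c₀ := by rw [hA₁]; ring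
    rw [h]
    exact (hAB.add_mul_left_left (-C c₀)).symm
  have hrel : ∀ x, B.eval x ≠ 0 →
      B.eval x / A₁.eval x = (A.eval x / B.eval x - c₀)⁻¹ := by
    intro x hx
    rw [hA₁, eval_sub, eval_mul, eval_C, div_sub' hx, inv_div, mul_comm c₀]
  have hZ' : (Z ∪ {x | B.IsRoot x}).Finite := hZ.union (finite_setOfPred_isRoot hB)
  obtain ⟨G, H, hH, hGH⟩ := exists_eval_div_of_degree_lt (T := T) hcop hA₁0 hS hlt hZ' (by
    intro x₁ h₁ x₂ h₂ h
    rw [hrel x₁ fun h => h₁ (Or.inr h), hrel x₂ fun h => h₂ (Or.inr h)] at h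
    exact hconst x₁ (fun h => h₁ (Or.inl h)) x₂ (fun h => h₂ (Or.inl h))
      (sub_left_injective (inv_injective h)))
  obtain ⟨G', H', hH', hGH'⟩ := exists_eval_inv_sub G H hH c₀
  refine ⟨G', H', hH', ?_⟩
  filter_upwards [hGH, eventually_eval_ne_zero hB, eventually_eval_ne_zero hA₁0] with x h1 h2 h3
  rw [h1, hrel x h2]
  refine hGH' _ fun h => h3 ?_
  exact (eval_sub_C_mul_eq_zero_iff h2).mpr h

variable [DecidableEq L] [IsAlgClosed L] [CharZero L] {W W' W'' : WeierstrassCurve L}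
  [W.IsElliptic] [W'.IsElliptic]

/-- An even function on `W` that is constant on the fibres of an isogeny is a rational function of
the `x`-coordinate of the isogeny. -/
lemma IsIsogeny.exists_descent {φ : W.toAffine.Point →+ W'.toAffine.Point} (hφ : IsIsogeny L φ)
    {f : W.toAffine.Point → L} {T S : L[X]} (hS : S ≠ 0)
    (hf : ∀ᶠ P in cofinite, f P = T.eval (xc P) / S.eval (xc P))
    (hconst : ∀ᶠ P in cofinite, ∀ Q, φ P ≠ 0 → φ Q ≠ 0 → xc (φ P) = xc (φ Q) → f P = f Q) :
    ∃ G H : L[X], H ≠ 0 ∧ ∀ᶠ P in cofinite, f P = G.eval (xc (φ P)) / H.eval (xc (φ P)) := by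
  obtain ⟨A, B, hAB, hB, hx⟩ := hφ.exists_xc_form
  have := infinite_point W
  have hN : 0 < max A.natDegree B.natDegree := by
    rw [← (hφ.surjective_and_card_ker hAB hB hx).2]
    have : Finite φ.ker := hφ.finite_ker
    exact Nat.card_pos
  have hgood := eventually_forall_xc (((hφ.eventually_ne.and hx).and hf).and hconst)
  rw [eventually_cofinite] at hgood
  obtain ⟨G, H, hH, hGH⟩ := exists_eval_div (T := T) hAB hB hS hN hgood (by
    intro x₁ h₁ x₂ h₂ h
    simp only [Set.mem_ofPred_eq, not_not] at h₁ h₂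
    obtain ⟨P₁, hP₁, rfl⟩ := exists_xc_eq (W := W) x₁
    obtain ⟨P₂, hP₂, rfl⟩ := exists_xc_eq (W := W) x₂
    obtain ⟨⟨⟨h3, h4⟩, h5⟩, h6⟩ := h₁ P₁ hP₁ rfl
    obtain ⟨⟨⟨h3', h4'⟩, h5'⟩, h6'⟩ := h₂ P₂ hP₂ rfl
    rw [← h5, ← h5']
    exact h6 _ h3 h3' (by rw [h4, h4', h]))
  refine ⟨G, H, hH, ?_⟩
  filter_upwards [hf, hx, tendsto_xc.eventually hGH] with P h1 h2 h3
  rw [h1, h3, h2]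

lemma eventually_of_eventually_comp {A B : Type*} {φ : A → B} (hφ : Function.Surjective φ)
    {p : B → Prop} (h : ∀ᶠ a in cofinite, p (φ a)) : ∀ᶠ b in cofinite, p b := by
  rw [eventually_cofinite] at h ⊢
  refine (h.image φ).subset fun b hb => ?_
  obtain ⟨a, rfl⟩ := hφ b
  exact ⟨a, hb, rfl⟩

/-- If `g ∘ φ` and `φ` are isogenies, so is `g`. -/
lemma IsIsogeny.of_comp {φ : W.toAffine.Point →+ W'.toAffine.Point} (hφ : IsIsogeny L φ)
    {g : W'.toAffine.Point →+ W''.toAffine.Point} (h : IsIsogeny L (g.comp φ)) :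
    IsIsogeny L g := by
  have hsurj := hφ.surjective
  have hpm : ∀ P Q, φ P ≠ 0 → φ Q ≠ 0 → xc (φ P) = xc (φ Q) → φ P = φ Q ∨ φ P = -φ Q :=
    fun P Q h1 h2 h3 => eq_or_eq_neg_of_xc_eq h1 h2 h3
  -- Equal x-coordinates leave a sign ambiguity φ P = ±φ Q. The odd coordinate feels it, so `om (g
  -- (φ P))` is divided by `om (φ P)` before descending.
  have hsign : ∀ P Q, φ P ≠ 0 → φ Q ≠ 0 → xc (φ P) = xc (φ Q) →
      xc (g (φ P)) = xc (g (φ Q)) ∧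
      om (g (φ P)) / om (φ P) = om (g (φ Q)) / om (φ Q) := by
    intro P Q h1 h2 h3
    rcases hpm P Q h1 h2 h3 with h4 | h4
    · rw [h4]
      exact ⟨rfl, rfl⟩
    · rw [h4, map_neg, xc_neg, om_neg, om_neg, neg_div_neg_eq]
      exact ⟨rfl, rfl⟩
  obtain ⟨A, B, -, hB, hx⟩ := h.exists_xc_form
  obtain ⟨G, H, hH, hGH⟩ := hφ.exists_descent hB hx
    (.of_forall fun P Q h1 h2 h3 => (hsign P Q h1 h2 h3).1)
  have hωφ : ∀ᶠ P in cofinite, om (φ P) ≠ 0 := hφ.tendsto.eventually eventually_om_ne_zero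
  obtain ⟨S, T, hT, hST⟩ := (h.isRat_om.div hφ.isRat_om hωφ).even_form fun P => by
    rw [map_neg, map_neg, om_neg, om_neg, neg_div_neg_eq]
  obtain ⟨G', H', hH', hGH'⟩ := hφ.exists_descent hT hST
    (.of_forall fun P Q h1 h2 h3 => (hsign P Q h1 h2 h3).2)
  refine .of_isRat (eventually_of_eventually_comp hsurj h.eventually_ne)
    ⟨G, 0, H, hH, eventually_of_eventually_comp hsurj ?_⟩
    ⟨0, G', H', hH', eventually_of_eventually_comp hsurj ?_⟩
  · filter_upwards [hGH] with P hP
    simpa using hP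
  · filter_upwards [hGH', hωφ] with P hP hω
    rw [AddMonoidHom.comp_apply, div_eq_iff hω] at hP
    rw [hP, eval_zero]
    ring

end Descent

/-! ### Addition formulas for the x-coordinate. -/

section Addition

variable {L : Type*} [Field L] [DecidableEq L] {W : WeierstrassCurve L}

lemma add_ne_zero_of_xc_ne {P Q : W.toAffine.Point} (h : xc P ≠ xc Q) : P + Q ≠ 0 := fun h0 =>
  h (by rw [eq_neg_of_add_eq_zero_left h0, xc_neg])

lemma xc_yc_add {P Q : W.toAffine.Point} (hP : P ≠ 0) (hQ : Q ≠ 0) (h : xc P ≠ xc Q) :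
    xc (P + Q) = ((yc P - yc Q) / (xc P - xc Q)) ^ 2 +
      W.a₁ * ((yc P - yc Q) / (xc P - xc Q)) - W.a₂ - xc P - xc Q ∧
    yc (P + Q) = -((yc P - yc Q) / (xc P - xc Q) * (xc (P + Q) - xc P) + yc P) -
      W.a₁ * xc (P + Q) - W.a₃ := by
  match P, Q, hP, hQ with
  | .zero, _, hP, _ => exact absurd rfl hP
  | _, .zero, _, hQ => exact absurd rfl hQ
  | .some x₁ y₁ h₁, .some x₂ y₂ h₂, _, _ =>
    replace h : x₁ ≠ x₂ := h
    have hs := Affine.slope_of_X_ne (W := W.toAffine) (y₁ := y₁) (y₂ := y₂) h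
    rw [Affine.Point.add_of_X_ne h]
    simp only [xc_some, yc_some, Affine.addX, Affine.addY, Affine.negAddY, Affine.negY] at hs ⊢
    rw [hs]
    exact ⟨rfl, rfl⟩

lemma xc_yc_add_self {P : W.toAffine.Point} (hP : P ≠ 0) (h : om P ≠ 0) :
    xc (P + P) = ((3 * xc P ^ 2 + 2 * W.a₂ * xc P + W.a₄ - W.a₁ * yc P) / om P) ^ 2 +
      W.a₁ * ((3 * xc P ^ 2 + 2 * W.a₂ * xc P + W.a₄ - W.a₁ * yc P) / om P) -
      W.a₂ - xc P - xc P ∧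
    yc (P + P) = -((3 * xc P ^ 2 + 2 * W.a₂ * xc P + W.a₄ - W.a₁ * yc P) / om P *
      (xc (P + P) - xc P) + yc P) - W.a₁ * xc (P + P) - W.a₃ := by
  match P, hP with
  | .zero, hP => exact absurd rfl hP
  | .some x y h₁, _ =>
    have hy : y ≠ W.toAffine.negY x y := fun hy => h (om_eq_zero_iff.mpr (by
      rw [Affine.Point.neg_some, Affine.Point.some.injEq]
      exact ⟨rfl, hy⟩))
    have hs := Affine.slope_of_Y_ne (W := W.toAffine) (x₁ := x) (x₂ := x) (y₁ := y) (y₂ := y)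
      rfl hy
    have hω : y - W.toAffine.negY x y = om (Affine.Point.some x y h₁) := by
      rw [Affine.negY, om_some]
      ring
    rw [hω] at hs
    rw [Affine.Point.add_self_of_Y_ne hy]
    refine ⟨?_, ?_⟩ <;>
      simp only [xc_some, yc_some, Affine.addX, Affine.addY, Affine.negAddY, hs]
    rfl

variable [CharZero L]

lemma xc_add_eq {P Q : W.toAffine.Point} (hP : P ≠ 0) (hQ : Q ≠ 0) (h : xc P ≠ xc Q) :
    xc (P + Q) = (om P - om Q) ^ 2 / (4 * (xc P - xc Q) ^ 2) - W.b₂ / 4 - xc P - xc Q := by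
  have h' : xc P - xc Q ≠ 0 := sub_ne_zero.mpr h
  rw [(xc_yc_add hP hQ h).1, om_eq hP, om_eq hQ, b₂]
  field_simp
  ring

/-- Passing from Q to -Q only changes the sign of `om Q`, so the sum and the product of x(P + Q) and
x(P - Q) involve only even powers of it. They are the coefficients of the quadratic used in
`IsIsogeny.card_ker_add_le`. -/
lemma xc_add_add_xc_sub {P Q : W.toAffine.Point} (hP : P ≠ 0) (hQ : Q ≠ 0) (h : xc P ≠ xc Q) :
    (xc P - xc Q) ^ 2 * (xc (P + Q) + xc (P - Q)) =
      2 * (xc P + xc Q) * (xc P * xc Q) + W.b₂ * (xc P * xc Q) + W.b₄ * (xc P + xc Q) + W.b₆ := by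
  have h' : xc P - xc Q ≠ 0 := sub_ne_zero.mpr h
  have h1 := om_sq hP
  have h2 := om_sq hQ
  simp only [Ψ₂Sq, eval_add, eval_mul, eval_C, eval_pow, eval_X] at h1 h2
  rw [xc_add_eq hP hQ h, sub_eq_add_neg P, xc_add_eq hP (neg_ne_zero.mpr hQ) (by simpa using h),
    xc_neg, om_neg]
  field_simp
  linear_combination 2 * h1 + 2 * h2

lemma xc_add_mul_xc_sub {P Q : W.toAffine.Point} (hP : P ≠ 0) (hQ : Q ≠ 0) (h : xc P ≠ xc Q) :
    (xc P - xc Q) ^ 2 * (xc (P + Q) * xc (P - Q)) =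
      (xc P * xc Q) ^ 2 - W.b₄ * (xc P * xc Q) - W.b₆ * (xc P + xc Q) - W.b₈ := by
  have h' : xc P - xc Q ≠ 0 := sub_ne_zero.mpr h
  have h1 := om_sq hP
  have h2 := om_sq hQ
  have h3 := W.b_relation
  simp only [Ψ₂Sq, eval_add, eval_mul, eval_C, eval_pow, eval_X] at h1 h2
  rw [xc_add_eq hP hQ h, sub_eq_add_neg P, xc_add_eq hP (neg_ne_zero.mpr hQ) (by simpa using h),
    xc_neg, om_neg]
  generalize xc P = x at *
  generalize xc Q = z at *
  have key : ((om P - om Q) ^ 2 / (4 * (x - z) ^ 2) - W.b₂ / 4 - x - z) *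
      ((om P - -om Q) ^ 2 / (4 * (x - z) ^ 2) - W.b₂ / 4 - x - z) =
      (om P ^ 2 - om Q ^ 2) ^ 2 / (16 * (x - z) ^ 4) -
        (W.b₂ / 4 + x + z) * (om P ^ 2 + om Q ^ 2) / (2 * (x - z) ^ 2) +
        (W.b₂ / 4 + x + z) ^ 2 := by
    field_simp
    ring
  rw [key, h1, h2]
  have h8 : W.b₈ = (W.b₂ * W.b₆ - W.b₄ ^ 2) / 4 := by linear_combination h3 / 4
  rw [h8]
  field_simp
  ring

end Addition

/-! ### Multiplication by an integer is an isogeny. -/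

section Multiplication

variable {L : Type*} [Field L] [DecidableEq L] {W W' : WeierstrassCurve L}
  [IsAlgClosed L] [CharZero L] [W.IsElliptic]

lemma IsIsogeny.add {φ ψ : W.toAffine.Point →+ W'.toAffine.Point} (hφ : IsIsogeny L φ)
    (hψ : IsIsogeny L ψ) (h : ∀ᶠ P in cofinite, xc (φ P) ≠ xc (ψ P)) : IsIsogeny L (φ + ψ) := by
  have h' : ∀ᶠ P in cofinite, xc (φ P) - xc (ψ P) ≠ 0 := h.mono fun P hP => sub_ne_zero.mpr hP
  have hs := (hφ.isRat_yc.sub hψ.isRat_yc).div (hφ.isRat_xc.sub hψ.isRat_xc) h'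
  have hx : IsRat fun P => xc ((φ + ψ) P) := by
    refine (((((hs.pow 2).add ((IsRat.const W'.a₁).mul hs)).sub (IsRat.const W'.a₂)).sub
      hφ.isRat_xc).sub hψ.isRat_xc).congr ?_
    filter_upwards [hφ.eventually_ne, hψ.eventually_ne, h] with P h1 h2 h3
    exact (xc_yc_add h1 h2 h3).1
  refine isIsogeny_iff.mpr ⟨?_, hx, ?_⟩
  · filter_upwards [h] with P hP
    exact add_ne_zero_of_xc_ne hP
  · refine (((((hs.mul (hx.sub hφ.isRat_xc)).add hφ.isRat_yc).neg).sub
      ((IsRat.const W'.a₁).mul hx)).sub (IsRat.const W'.a₃)).congr ?_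
    filter_upwards [hφ.eventually_ne, hψ.eventually_ne, h] with P h1 h2 h3
    exact (xc_yc_add h1 h2 h3).2

variable (W)

lemma isIsogeny_one : IsIsogeny L (zsmulAddGroupHom 1 : W.toAffine.Point →+ _) := by
  refine isIsogeny_iff.mpr ⟨?_, ?_, ?_⟩ <;> simp only [zsmulAddGroupHom_apply, one_zsmul]
  exacts [eventually_ne_zero, .xc, .yc]

lemma isIsogeny_two : IsIsogeny L (zsmulAddGroupHom 2 : W.toAffine.Point →+ _) := by
  have hs : IsRat fun P : W.toAffine.Point =>
      (3 * xc P ^ 2 + 2 * W.a₂ * xc P + W.a₄ - W.a₁ * yc P) / om P :=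
    ((((((IsRat.const 3).mul (IsRat.xc.pow 2)).add ((IsRat.const (2 * W.a₂)).mul .xc)).add
      (.const W.a₄)).sub ((IsRat.const W.a₁).mul .yc))).div .om eventually_om_ne_zero
  have hx : IsRat fun P : W.toAffine.Point => xc (P + P) := by
    refine (((((hs.pow 2).add ((IsRat.const W.a₁).mul hs)).sub (IsRat.const W.a₂)).sub
      .xc).sub .xc).congr ?_
    filter_upwards [eventually_ne_zero, eventually_om_ne_zero] with P h1 h2
    exact (xc_yc_add_self h1 h2).1
  refine isIsogeny_iff.mpr ⟨?_, ?_, ?_⟩ <;> simp only [zsmulAddGroupHom_apply, two_zsmul]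
  · filter_upwards [eventually_om_ne_zero (W := W)] with P h1 h2
    exact h1 (om_eq_zero_iff.mpr (eq_neg_of_add_eq_zero_left h2))
  · exact hx
  · refine (((((hs.mul (hx.sub .xc)).add .yc).neg).sub
      ((IsRat.const W.a₁).mul hx)).sub (IsRat.const W.a₃)).congr ?_
    filter_upwards [eventually_ne_zero, eventually_om_ne_zero] with P h1 h2
    exact (xc_yc_add_self h1 h2).2

/-- Nonzero 2-torsion points correspond under x to the roots of a separable cubic. -/
lemma card_two_torsion :
    Nat.card (zsmulAddGroupHom 2 : W.toAffine.Point →+ W.toAffine.Point).ker = 4 := by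
  have hker : ((zsmulAddGroupHom 2 : W.toAffine.Point →+ W.toAffine.Point).ker :
      Set W.toAffine.Point) = insert 0 {P | P ≠ 0 ∧ om P = 0} := by
    ext P
    simp only [SetLike.mem_coe, AddMonoidHom.mem_ker, zsmulAddGroupHom_apply, two_zsmul,
      Set.mem_insert_iff, Set.mem_ofPred_eq, om_eq_zero_iff, eq_neg_iff_add_eq_zero]
    by_cases h : P = 0 <;> simp [h]
  have hroots : W.Ψ₂Sq.roots.toFinset.card = 3 := by
    have h := Cubic.card_roots_of_discr_ne_zero (φ := RingHom.id L)
      (P := W.twoTorsionPolynomial) (by simp [twoTorsionPolynomial]) (IsAlgClosed.splits _)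
      (W.twoTorsionPolynomial_discr_ne_zero_of_isElliptic (isUnit_iff_ne_zero.mpr two_ne_zero))
    rwa [Cubic.map_roots, Polynomial.map_id, ← Ψ₂Sq_eq] at h
  have himg : xc '' {P : W.toAffine.Point | P ≠ 0 ∧ om P = 0} =
      (W.Ψ₂Sq.roots.toFinset : Set L) := by
    ext x
    simp only [Set.mem_image, Set.mem_ofPred_eq, Finset.mem_coe, Multiset.mem_toFinset,
      mem_roots (Ψ₂Sq_ne_zero' W), IsRoot.def]
    constructor
    · rintro ⟨P, ⟨h1, h2⟩, rfl⟩
      rw [← om_sq h1, h2]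
      ring
    · intro h
      obtain ⟨P, h1, rfl⟩ := exists_xc_eq (W := W) x
      exact ⟨P, ⟨h1, by rwa [← om_sq h1, sq_eq_zero_iff] at h⟩, rfl⟩
  have hinj : Set.InjOn xc {P : W.toAffine.Point | P ≠ 0 ∧ om P = 0} := by
    rintro P ⟨h1, h2⟩ Q ⟨h3, h4⟩ h
    rcases eq_or_eq_neg_of_xc_eq h1 h3 h with h5 | h5
    · exact h5
    · rwa [← om_eq_zero_iff.mp h4] at h5
  have hcard : {P : W.toAffine.Point | P ≠ 0 ∧ om P = 0}.ncard = 3 := by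
    rw [← hinj.ncard_image, himg, Set.ncard_coe_finset, hroots]
  have hk : (((zsmulAddGroupHom 2 : W.toAffine.Point →+ W.toAffine.Point).ker :
      Set W.toAffine.Point)).ncard = 4 := by
    rw [hker, Set.ncard_insert_of_notMem (by simp)
      (Set.finite_of_ncard_ne_zero (by rw [hcard]; norm_num)), hcard]
  rw [← hk, ← Nat.card_coe_set_eq]
  rfl

lemma exists_two_torsion : ∃ P : W.toAffine.Point, P ≠ 0 ∧ P + P = 0 := by
  have h := card_two_torsion W
  have : Nontrivial (zsmulAddGroupHom 2 : W.toAffine.Point →+ W.toAffine.Point).ker := by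
    have : Finite (zsmulAddGroupHom 2 : W.toAffine.Point →+ W.toAffine.Point).ker :=
      Nat.finite_of_card_ne_zero (by rw [h]; norm_num)
    exact Finite.one_lt_card_iff_nontrivial.mp (by rw [h]; norm_num)
  obtain ⟨⟨P, hP⟩, hne⟩ := exists_ne
    (0 : (zsmulAddGroupHom 2 : W.toAffine.Point →+ W.toAffine.Point).ker)
  refine ⟨P, fun h => hne (Subtype.ext h), ?_⟩
  rwa [AddMonoidHom.mem_ker, zsmulAddGroupHom_apply, two_zsmul] at hP

/-- The chord formula gives [m + 1] = [m] + [1] unless x(mP) = x(P) identically. In that case mP = P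
is generically excluded by [m - 1], and mP = -P would make [m + 1] vanish. -/
lemma isIsogeny_natCast {n : ℕ} (hn : 0 < n) :
    IsIsogeny L (zsmulAddGroupHom (n : ℤ) : W.toAffine.Point →+ _) := by
  have := infinite_point W
  induction n using Nat.strong_induction_on with
  | _ n ih =>
    obtain rfl | rfl | ⟨m, hm, rfl⟩ : n = 1 ∨ n = 2 ∨ ∃ m, 2 ≤ m ∧ n = m + 1 := by
      rcases n with _ | _ | _ | n
      · omega
      · simp
      · simp
      · exact Or.inr (Or.inr ⟨n + 2, by omega, rfl⟩)
    · exact_mod_cast isIsogeny_one W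
    · exact_mod_cast isIsogeny_two W
    have h1 := ih m (by omega) (by omega)
    obtain ⟨k, rfl⟩ : ∃ k, m = k + 1 := ⟨m - 1, by omega⟩
    have h2 := ih k (by omega) (by omega)
    have hsum : (zsmulAddGroupHom ((k + 1 + 1 : ℕ) : ℤ) : W.toAffine.Point →+ _) =
        zsmulAddGroupHom ((k + 1 : ℕ) : ℤ) + zsmulAddGroupHom 1 := by
      ext P
      simp [add_smul]
    rw [hsum]
    refine h1.add (isIsogeny_one W) ?_
    obtain ⟨A, B, -, hB, hx⟩ := h1.exists_xc_form
    by_cases hAB : A - X * B = 0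
    · exfalso
      have hz : (zsmulAddGroupHom ((k + 1 + 1 : ℕ) : ℤ) : W.toAffine.Point →+ _) = 0 := by
        refine hom_ext_of_eventually_eq ?_
        filter_upwards [hx, tendsto_xc.eventually (eventually_eval_ne_zero hB), h1.eventually_ne,
          h2.eventually_ne, eventually_ne_zero] with P h3 h4 h5 h6 h7
        have h8 : xc (zsmulAddGroupHom ((k + 1 : ℕ) : ℤ) P) = xc P := by
          rw [h3, div_eq_iff h4]
          simpa [sub_eq_zero] using congrArg (Polynomial.eval (xc P)) hAB
        rcases eq_or_eq_neg_of_xc_eq h5 h7 h8 with h9 | h9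
        · refine absurd ?_ h6
          simpa [add_smul] using h9
        · rw [hsum, AddMonoidHom.add_apply, h9]
          simp
      have hz' : ∀ P : W.toAffine.Point, ((k + 1 + 1 : ℕ) : ℤ) • P = 0 := fun P =>
        DFunLike.congr_fun hz P
      -- Multiplication by 2r cannot vanish, for then [r] would vanish by surjectivity of [2]. An
      -- odd multiple does not kill a nonzero 2-torsion point.
      rcases Nat.even_or_odd' (k + 1 + 1) with ⟨r, hr | hr⟩
      · obtain ⟨Q, hQ⟩ := (ih r (by omega) (by omega)).eventually_ne.exists
        obtain ⟨P, rfl⟩ := (isIsogeny_two W).surjective Q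
        apply hQ
        have := hz' P
        rw [hr] at this
        rw [Nat.cast_mul, mul_comm, mul_zsmul] at this
        exact this
      · obtain ⟨P, hP, hPP⟩ := exists_two_torsion W
        have := hz' P
        rw [hr] at this
        rw [← two_zsmul] at hPP
        apply hP
        simpa [add_smul, mul_comm (2 : ℤ), mul_smul, hPP] using this
    · filter_upwards [hx, tendsto_xc.eventually (eventually_eval_ne_zero hB),
        tendsto_xc.eventually (eventually_eval_ne_zero hAB)] with P h3 h4 h5 h6
      apply h5
      rw [h3, div_eq_iff h4] at h6
      simpa [sub_eq_zero] using h6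

end Multiplication

/-! ### The parallelogram inequality and the order of the n-torsion. -/

section Parallelogram

variable {L : Type*} [Field L] {W W' : WeierstrassCurve L}

lemma eventually_forall_of_xc_eq (φ : W.toAffine.Point → W'.toAffine.Point)
    {p : W.toAffine.Point → Prop} (h : ∀ᶠ P in cofinite, p P) :
    ∀ᶠ c in cofinite, ∀ P, xc (φ P) = c → p P := by
  rw [eventually_cofinite] at h ⊢
  refine (h.image fun P => xc (φ P)).subset fun c hc => ?_
  simp only [Set.mem_ofPred_eq, not_forall] at hc
  obtain ⟨P, hPc, hP⟩ := hc
  exact ⟨P, hP, hPc⟩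

/-- The quadratic in c with roots x(φP + ψP) and x(φP - ψP), cleared of denominators: s/u and t/u
are the product and the sum of x(φP) and x(ψP). -/
lemma natDegree_addSub_le {s t u : L[X]} {h : ℕ} (hs : s.natDegree ≤ h) (ht : t.natDegree ≤ h)
    (hu : u.natDegree ≤ h) (c b₂ b₄ b₆ b₈ : L) :
    (C (c ^ 2) * (t ^ 2 - 4 * (s * u)) -
      C c * (2 * (t * s) + C b₂ * (s * u) + C b₄ * (t * u) + C b₆ * u ^ 2) +
      (s ^ 2 - C b₄ * (s * u) - C b₆ * (t * u) - C b₈ * u ^ 2)).natDegree ≤ 2 * h := by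
  have hmul : ∀ {p q : L[X]}, p.natDegree ≤ h → q.natDegree ≤ h → (p * q).natDegree ≤ 2 * h :=
    fun hp hq => (natDegree_mul_le_of_le hp hq).trans (two_mul h).ge
  have hsq : ∀ {p : L[X]}, p.natDegree ≤ h → (p ^ 2).natDegree ≤ 2 * h := fun hp => by
    rw [sq]; exact hmul hp hp
  have hC : ∀ (a : L) {p : L[X]}, p.natDegree ≤ 2 * h → (C a * p).natDegree ≤ 2 * h :=
    fun a _ hp => (natDegree_C_mul_le a _).trans hp
  have hadd : ∀ {p q : L[X]}, p.natDegree ≤ 2 * h → q.natDegree ≤ 2 * h →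
      (p + q).natDegree ≤ 2 * h := fun hp hq => natDegree_add_le_of_degree_le hp hq
  have hsub : ∀ {p q : L[X]}, p.natDegree ≤ 2 * h → q.natDegree ≤ 2 * h →
      (p - q).natDegree ≤ 2 * h := fun hp hq => natDegree_sub_le_of_le hp hq |>.trans (by simp)
  have h4 : (4 : L[X]) = C 4 := rfl
  have h2 : (2 : L[X]) = C 2 := rfl
  rw [h4, h2]
  exact hadd (hsub (hC _ (hsub (hsq ht) (hC _ (hmul hs hu))))
    (hC _ (hadd (hadd (hadd (hC _ (hmul ht hs)) (hC _ (hmul hs hu))) (hC _ (hmul ht hu)))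
      (hC _ (hsq hu)))))
    (hsub (hsub (hsub (hsq hs) (hC _ (hmul hs hu))) (hC _ (hmul ht hu))) (hC _ (hsq hu)))

variable [DecidableEq L] [IsAlgClosed L] [CharZero L] [W.IsElliptic] [W'.IsElliptic]

lemma IsIsogeny.eventually_ncard_xc_fibre {φ : W.toAffine.Point →+ W'.toAffine.Point}
    (hφ : IsIsogeny L φ) : ∀ᶠ c in cofinite,
      (xc '' {P | φ P ≠ 0 ∧ xc (φ P) = c}).ncard = Nat.card φ.ker := by
  filter_upwards [eventually_forall_xc (W := W') eventually_om_ne_zero] with c hc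
  obtain ⟨Q, hQ, rfl⟩ := exists_xc_eq (W := W') c
  exact ncard_xc_fibre (hc Q hQ rfl) (hφ.surjective Q)

/-- One half of the parallelogram law for the degree of isogenies. -/
lemma IsIsogeny.card_ker_add_le {φ ψ : W.toAffine.Point →+ W'.toAffine.Point}
    (hφ : IsIsogeny L φ) (hψ : IsIsogeny L ψ) (hadd : IsIsogeny L (φ + ψ))
    (hsub : IsIsogeny L (φ - ψ)) :
    Nat.card (φ + ψ).ker + Nat.card (φ - ψ).ker ≤
      2 * (Nat.card φ.ker + Nat.card ψ.ker) := by
  have := infinite_point W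
  have : Infinite L := IsAlgClosed.instInfinite
  obtain ⟨A₁, B₁, hAB₁, hB₁, hx₁⟩ := hφ.exists_xc_form
  obtain ⟨A₂, B₂, hAB₂, hB₂, hx₂⟩ := hψ.exists_xc_form
  rw [(hφ.surjective_and_card_ker hAB₁ hB₁ hx₁).2, (hψ.surjective_and_card_ker hAB₂ hB₂ hx₂).2]
  set h₁ := max A₁.natDegree B₁.natDegree
  set h₂ := max A₂.natDegree B₂.natDegree
  have hA₁ : A₁.natDegree ≤ h₁ := le_max_left _ _
  have hB₁' : B₁.natDegree ≤ h₁ := le_max_right _ _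
  have hA₂ : A₂.natDegree ≤ h₂ := le_max_left _ _
  have hB₂' : B₂.natDegree ≤ h₂ := le_max_right _ _
  set s := A₁ * A₂ with hs
  set t := A₁ * B₂ + B₁ * A₂ with ht
  set u := B₁ * B₂ with hu
  set q : L → L[X] := fun c => C (c ^ 2) * (t ^ 2 - 4 * (s * u)) -
      C c * (2 * (t * s) + C W'.b₂ * (s * u) + C W'.b₄ * (t * u) + C W'.b₆ * u ^ 2) +
      (s ^ 2 - C W'.b₄ * (s * u) - C W'.b₆ * (t * u) - C W'.b₈ * u ^ 2) with hq
  have hdeg : ∀ c, (q c).natDegree ≤ 2 * (h₁ + h₂) := fun c =>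
    natDegree_addSub_le (natDegree_mul_le_of_le hA₁ hA₂)
      (natDegree_add_le_of_degree_le (natDegree_mul_le_of_le hA₁ hB₂')
        (natDegree_mul_le_of_le hB₁' hA₂)) (natDegree_mul_le_of_le hB₁' hB₂') c _ _ _ _
  have hne : ∀ᶠ P in cofinite, xc (φ P) ≠ xc (ψ P) := by
    filter_upwards [hφ.eventually_ne, hψ.eventually_ne, hadd.eventually_ne,
      hsub.eventually_ne] with P h1 h2 h3 h4 h5
    rcases eq_or_eq_neg_of_xc_eq h1 h2 h5 with h6 | h6
    · exact h4 (by rw [AddMonoidHom.sub_apply, h6, sub_self])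
    · exact h3 (by rw [AddMonoidHom.add_apply, h6, neg_add_cancel])
  have hgood : ∀ᶠ P in cofinite, (φ P ≠ 0 ∧ ψ P ≠ 0 ∧ xc (φ P) ≠ xc (ψ P)) ∧
      (xc (φ P) = A₁.eval (xc P) / B₁.eval (xc P) ∧ B₁.eval (xc P) ≠ 0) ∧
      (xc (ψ P) = A₂.eval (xc P) / B₂.eval (xc P) ∧ B₂.eval (xc P) ≠ 0) ∧
      om (φ P) ≠ 0 ∧ om (ψ P) ≠ 0 := by
    filter_upwards [hφ.eventually_ne, hψ.eventually_ne, hne, hx₁, hx₂,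
      tendsto_xc.eventually (eventually_eval_ne_zero hB₁),
      tendsto_xc.eventually (eventually_eval_ne_zero hB₂),
      hφ.tendsto.eventually eventually_om_ne_zero,
      hψ.tendsto.eventually eventually_om_ne_zero] with P h1 h2 h3 h4 h5 h6 h7 h8 h9
    exact ⟨⟨h1, h2, h3⟩, ⟨h4, h6⟩, ⟨h5, h7⟩, h8, h9⟩
  have heval : ∀ P, ((φ P ≠ 0 ∧ ψ P ≠ 0 ∧ xc (φ P) ≠ xc (ψ P)) ∧
      (xc (φ P) = A₁.eval (xc P) / B₁.eval (xc P) ∧ B₁.eval (xc P) ≠ 0) ∧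
      (xc (ψ P) = A₂.eval (xc P) / B₂.eval (xc P) ∧ B₂.eval (xc P) ≠ 0) ∧
      om (φ P) ≠ 0 ∧ om (ψ P) ≠ 0) → ∀ c, (q c).eval (xc P) =
        ((B₁.eval (xc P) * B₂.eval (xc P)) * (xc (φ P) - xc (ψ P))) ^ 2 *
          ((c - xc (φ P + ψ P)) * (c - xc (φ P - ψ P))) := by
    rintro P ⟨⟨h1, h2, h3⟩, ⟨h4, h5⟩, ⟨h6, h7⟩, -⟩ c
    have e1 := xc_add_add_xc_sub h1 h2 h3
    have e2 := xc_add_mul_xc_sub h1 h2 h3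
    have e3 : A₁.eval (xc P) = xc (φ P) * B₁.eval (xc P) := by rw [h4, div_mul_cancel₀ _ h5]
    have e4 : A₂.eval (xc P) = xc (ψ P) * B₂.eval (xc P) := by rw [h6, div_mul_cancel₀ _ h7]
    have h44 : (4 : L[X]) = C 4 := rfl
    have h22 : (2 : L[X]) = C 2 := rfl
    simp only [hq, hs, ht, hu, h44, h22, eval_add, eval_sub, eval_mul, eval_C, eval_pow, e3, e4]
    linear_combination (B₁.eval (xc P) * B₂.eval (xc P)) ^ 2 * (c * e1 - e2)
  have hq0 : ∀ᶠ c in cofinite, q c ≠ 0 := by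
    obtain ⟨P, hP⟩ := hgood.exists
    have hset := (Set.toFinite {xc (φ P + ψ P), xc (φ P - ψ P)}).eventually_cofinite_notMem
    filter_upwards [hset] with c hc h0
    have h1 := heval P hP c
    rw [h0, eval_zero] at h1
    simp only [Set.mem_insert_iff, Set.mem_singleton_iff, not_or] at hc
    refine mul_ne_zero (pow_ne_zero 2 (mul_ne_zero (mul_ne_zero hP.2.1.2 hP.2.2.1.2)
      (sub_ne_zero.mpr hP.1.2.2))) (mul_ne_zero (sub_ne_zero.mpr hc.1) (sub_ne_zero.mpr hc.2))
      h1.symm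
  obtain ⟨c, h1, h2, h3, h4, h5⟩ := (hadd.eventually_ncard_xc_fibre.and
    (hsub.eventually_ncard_xc_fibre.and (hq0.and
      ((eventually_forall_of_xc_eq (φ + ψ) hgood).and
        (eventually_forall_of_xc_eq (φ - ψ) hgood))))).exists
  rw [← h1, ← h2]
  -- The x-coordinates of points P for which x(φP + ψP) or x(φP - ψP) equals c are roots of q c,
  -- whose degree is at most 2(h₁ + h₂). Disjointness of the two sets turns this into the inequality
  -- for the sum.
  have hsub1 : xc '' {P | (φ + ψ) P ≠ 0 ∧ xc ((φ + ψ) P) = c} ⊆ ((q c).roots.toFinset : Set L) := by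
    rintro _ ⟨P, ⟨-, hP⟩, rfl⟩
    rw [Finset.mem_coe, Multiset.mem_toFinset, mem_roots h3, IsRoot.def, heval P (h4 P hP) c]
    rw [AddMonoidHom.add_apply] at hP
    simp [hP]
  have hsub2 : xc '' {P | (φ - ψ) P ≠ 0 ∧ xc ((φ - ψ) P) = c} ⊆ ((q c).roots.toFinset : Set L) := by
    rintro _ ⟨P, ⟨-, hP⟩, rfl⟩
    rw [Finset.mem_coe, Multiset.mem_toFinset, mem_roots h3, IsRoot.def, heval P (h5 P hP) c]
    rw [AddMonoidHom.sub_apply] at hP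
    simp [hP]
  have hdisj : Disjoint (xc '' {P | (φ + ψ) P ≠ 0 ∧ xc ((φ + ψ) P) = c})
      (xc '' {P | (φ - ψ) P ≠ 0 ∧ xc ((φ - ψ) P) = c}) := by
    rw [Set.disjoint_left]
    rintro _ ⟨P, ⟨hP0, hP⟩, rfl⟩ ⟨Q, ⟨hQ0, hQ⟩, hQP⟩
    have hgP := h4 P hP
    have hxy : xc ((φ - ψ) P) = c ∧ (φ - ψ) P ≠ 0 := by
      rcases eq_or_ne P 0 with rfl | hP'
      · simp at hP0
      rcases eq_or_ne Q 0 with rfl | hQ'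
      · simp at hQ0
      rcases eq_or_eq_neg_of_xc_eq hQ' hP' hQP with rfl | rfl
      · exact ⟨hQ, hQ0⟩
      · rw [map_neg, xc_neg] at hQ
        rw [map_neg, neg_ne_zero] at hQ0
        exact ⟨hQ, hQ0⟩
    -- A common x-coordinate would give φP + ψP = ±(φP - ψP), making ψP or φP a 2-torsion point.
    rcases eq_or_eq_neg_of_xc_eq hP0 hxy.2 (hP.trans hxy.1.symm) with h | h <;>
      rw [AddMonoidHom.add_apply, AddMonoidHom.sub_apply] at h
    · refine hgP.2.2.2.2 (om_eq_zero_iff.mpr ?_)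
      rw [sub_eq_add_neg] at h
      exact add_left_cancel h
    · refine hgP.2.2.2.1 (om_eq_zero_iff.mpr ?_)
      rw [neg_sub, sub_eq_add_neg, add_comm (ψ P)] at h
      exact add_right_cancel h
  rw [← Set.ncard_union_eq hdisj (Set.Finite.subset (Finset.finite_toSet _) hsub1)
    (Set.Finite.subset (Finset.finite_toSet _) hsub2)]
  refine (Set.ncard_le_ncard (Set.union_subset hsub1 hsub2) (Finset.finite_toSet _)).trans ?_
  rw [Set.ncard_coe_finset]
  exact (Multiset.toFinset_card_le _).trans ((card_roots' _).trans (hdeg c))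

-- The degree f(n) of [n] has second difference 2. The parallelogram inequality for [n + 1] and [1]
-- gives one bound. For [n + 2] and [n] the sum and difference are [2n + 2] and [2], of degrees 4f(n
-- + 1) and 4, which gives the reverse bound.
variable (W) in
lemma card_torsion (n : ℕ) :
    Nat.card (zsmulAddGroupHom (n : ℤ) : W.toAffine.Point →+ W.toAffine.Point).ker = n ^ 2 := by
  have := infinite_point W
  set f : ℕ → ℕ := fun n =>
    Nat.card (zsmulAddGroupHom (n : ℤ) : W.toAffine.Point →+ W.toAffine.Point).ker with hf
  -- The kernel of [0] is infinite, and `Nat.card` assigns it 0, which happens to agree with 0².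
  have f0 : f 0 = 0 := by
    have : (zsmulAddGroupHom ((0 : ℕ) : ℤ) : W.toAffine.Point →+ W.toAffine.Point).ker = ⊤ := by
      ext P
      simp [AddMonoidHom.mem_ker]
    simp only [hf, this, AddSubgroup.card_top]
    exact Nat.card_eq_zero_of_infinite
  have f1 : f 1 = 1 := by
    have : (zsmulAddGroupHom ((1 : ℕ) : ℤ) : W.toAffine.Point →+ W.toAffine.Point).ker = ⊥ := by
      ext P
      simp [AddMonoidHom.mem_ker]
    simp only [hf, this, AddSubgroup.card_bot]
  have f2 : f 2 = 4 := card_two_torsion W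
  have fdouble : ∀ a, f (2 * a) = 4 * f a := by
    intro a
    have hc : (zsmulAddGroupHom ((2 * a : ℕ) : ℤ) : W.toAffine.Point →+ W.toAffine.Point) =
        (zsmulAddGroupHom (a : ℤ)).comp (zsmulAddGroupHom 2) := by
      ext P
      simp only [zsmulAddGroupHom_apply, AddMonoidHom.comp_apply]
      rw [Nat.cast_mul, mul_comm, mul_zsmul]
      rfl
    simp only [hf, hc]
    rw [card_ker_comp _ (isIsogeny_two W).surjective, card_two_torsion]
  have fpar : ∀ a b, 0 < b → f (a + 2 * b) + f a ≤ 2 * (f (a + b) + f b) := by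
    intro a b hb
    rcases Nat.eq_zero_or_pos a with rfl | ha
    · rw [zero_add, zero_add, fdouble, f0]
      omega
    have e1 : (zsmulAddGroupHom ((a + 2 * b : ℕ) : ℤ) : W.toAffine.Point →+ W.toAffine.Point) =
        zsmulAddGroupHom ((a + b : ℕ) : ℤ) + zsmulAddGroupHom (b : ℤ) := by
      ext P
      simp only [zsmulAddGroupHom_apply, AddMonoidHom.add_apply, ← add_zsmul]
      congr 1
      push_cast
      ring
    have e2 : (zsmulAddGroupHom (a : ℤ) : W.toAffine.Point →+ W.toAffine.Point) =
        zsmulAddGroupHom ((a + b : ℕ) : ℤ) - zsmulAddGroupHom (b : ℤ) := by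
      ext P
      simp only [zsmulAddGroupHom_apply, AddMonoidHom.sub_apply, Nat.cast_add, add_zsmul,
        add_sub_cancel_right]
    have h := (isIsogeny_natCast W (n := a + b) (by omega)).card_ker_add_le
      (isIsogeny_natCast W hb) (e1 ▸ isIsogeny_natCast W (by omega))
      (e2 ▸ isIsogeny_natCast W ha)
    rwa [← e1, ← e2] at h
  have fstep : ∀ n, f (n + 2) + f n = 2 * f (n + 1) + 2 := by
    intro n
    refine le_antisymm ?_ ?_
    · have := fpar n 1 one_pos
      rw [f1] at this
      simpa [mul_add] using this
    · rcases Nat.eq_zero_or_pos n with rfl | hn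
      · simp [f0, f1, f2]
      have := fpar 2 n hn
      rw [show 2 + 2 * n = 2 * (n + 1) by ring, fdouble, f2, add_comm 2 n] at this
      omega
  have key : ∀ n, f n = n ^ 2 ∧ f (n + 1) = (n + 1) ^ 2 := by
    intro n
    induction n with
    | zero => simp [f0, f1]
    | succ n ih =>
      refine ⟨ih.2, ?_⟩
      have := fstep n
      rw [ih.1, ih.2] at this
      have e : (n + 1 + 1) ^ 2 + n ^ 2 = 2 * (n + 1) ^ 2 + 2 := by ring
      exact Nat.add_right_cancel (this.trans e.symm)
  exact (key n).1

end Parallelogram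

/-! ### Galois conjugation of curves, points and homomorphisms. -/

section Conjugation

variable {L : Type*} [Field L] [CharZero L] {W W' W'' V V' V'' U U' : WeierstrassCurve L}

/-- Conjugate curves are named through equations `W.map τ = V`, so that composite conjugations end
on a prescribed curve without transport. -/
lemma map_mul_eq {τ τ' : L ≃ₐ[ℚ] L} (h : W.map (τ : L →+* L) = V)
    (h' : V.map (τ' : L →+* L) = U) : W.map ((τ' * τ : L ≃ₐ[ℚ] L) : L →+* L) = U := by
  subst h h'
  rw [WeierstrassCurve.map_map]
  rfl

lemma map_inv_eq {τ : L ≃ₐ[ℚ] L} (h : W.map (τ : L →+* L) = V) :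
    V.map ((τ⁻¹ : L ≃ₐ[ℚ] L) : L →+* L) = W := by
  subst h
  rw [WeierstrassCurve.map_map]
  convert W.map_id
  ext x
  exact τ.symm_apply_apply x

lemma aeval_map_conj {k : Type*} [Field k] [Algebra k L] (τ : L ≃ₐ[ℚ] L) (x y : L)
    (p : MvPolynomial (Fin 2) k) :
    MvPolynomial.aeval ![τ x, τ y] (p.map ((τ : L →+* L).comp (algebraMap k L))) =
      τ (MvPolynomial.aeval ![x, y] p) := by
  rw [MvPolynomial.aeval_def, MvPolynomial.eval₂_map, MvPolynomial.aeval_def]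
  have h := MvPolynomial.eval₂_comp_left (τ : L →+* L) (algebraMap k L) ![x, y] p
  refine Eq.trans ?_ h.symm
  congr 1
  ext i
  fin_cases i <;> rfl

variable [DecidableEq L]

/-- The conjugation homomorphism `(x, y) ↦ (τ x, τ y)` from `W` to a curve equal to `W^τ`. -/
def conjHom (τ : L ≃ₐ[ℚ] L) (h : W.map (τ : L →+* L) = V) :
    W.toAffine.Point →+ V.toAffine.Point where
  toFun P := match P with
    | .zero => .zero
    | .some x y hxy => .some (τ x) (τ y) (by
        subst h
        exact (Affine.map_nonsingular W.toAffine (τ : L →+* L).injective x y).mpr hxy)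
  map_zero' := rfl
  map_add' P Q := by
    subst h
    convert (conjPoint (τ : L →+* L) W).map_add P Q using 1
    · rcases P with _ | _ <;> rcases Q with _ | _ <;> rfl
    · rcases P with _ | _ <;> rcases Q with _ | _ <;> rfl

lemma conjHom_rfl (τ : L ≃ₐ[ℚ] L) :
    conjHom (W := W) τ rfl = conjPoint (τ : L →+* L) W := by
  ext P
  rcases P with _ | _ <;> rfl

lemma conjHom_conjHom {τ τ' : L ≃ₐ[ℚ] L} (h : W.map (τ : L →+* L) = V)
    (h' : V.map (τ' : L →+* L) = U) (h'' : W.map ((τ' * τ : L ≃ₐ[ℚ] L) : L →+* L) = U)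
    (P : W.toAffine.Point) : conjHom τ' h' (conjHom τ h P) = conjHom (τ' * τ) h'' P := by
  rcases P with _ | _ <;> rfl

lemma conjHom_inv_conjHom {τ : L ≃ₐ[ℚ] L} (h : W.map (τ : L →+* L) = V)
    (P : W.toAffine.Point) : conjHom τ⁻¹ (map_inv_eq h) (conjHom τ h P) = P := by
  rcases P with _ | ⟨x, y, hxy⟩
  · rfl
  · change Affine.Point.some (τ.symm (τ x)) (τ.symm (τ y)) _ = _
    simp

lemma conjHom_conjHom_inv {τ : L ≃ₐ[ℚ] L} (h : W.map (τ : L →+* L) = V)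
    (P : V.toAffine.Point) : conjHom τ h (conjHom τ⁻¹ (map_inv_eq h) P) = P := by
  rcases P with _ | ⟨x, y, hxy⟩
  · rfl
  · change Affine.Point.some (τ (τ.symm x)) (τ (τ.symm y)) _ = _
    simp

/-- The conjugate `τ ∘ φ ∘ τ⁻¹` of a homomorphism. -/
def conjMap (τ : L ≃ₐ[ℚ] L) (h : W.map (τ : L →+* L) = V) (h' : W'.map (τ : L →+* L) = V')
    (φ : W.toAffine.Point →+ W'.toAffine.Point) : V.toAffine.Point →+ V'.toAffine.Point :=
  (conjHom τ h').comp (φ.comp (conjHom τ⁻¹ (map_inv_eq h)))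

lemma conjMap_conjHom {τ : L ≃ₐ[ℚ] L} (h : W.map (τ : L →+* L) = V)
    (h' : W'.map (τ : L →+* L) = V') (φ : W.toAffine.Point →+ W'.toAffine.Point)
    (P : W.toAffine.Point) : conjMap τ h h' φ (conjHom τ h P) = conjHom τ h' (φ P) := by
  simp only [conjMap, AddMonoidHom.comp_apply, conjHom_inv_conjHom]

lemma conjHom_surjective {τ : L ≃ₐ[ℚ] L} (h : W.map (τ : L →+* L) = V) :
    Function.Surjective (conjHom τ h) := fun P => ⟨_, conjHom_conjHom_inv h P⟩

lemma conjHom_injective {τ : L ≃ₐ[ℚ] L} (h : W.map (τ : L →+* L) = V) :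
    Function.Injective (conjHom τ h) := Function.LeftInverse.injective (conjHom_inv_conjHom h)

lemma ker_conjMap {τ : L ≃ₐ[ℚ] L} (h : W.map (τ : L →+* L) = V)
    (h' : W'.map (τ : L →+* L) = V') (φ : W.toAffine.Point →+ W'.toAffine.Point) :
    (conjMap τ h h' φ).ker = φ.ker.map (conjHom τ h) := by
  ext Q
  obtain ⟨P, rfl⟩ := conjHom_surjective h Q
  rw [AddMonoidHom.mem_ker, conjMap_conjHom, AddSubgroup.mem_map_iff_mem (conjHom_injective h),
    AddMonoidHom.mem_ker, map_eq_zero_iff _ (conjHom_injective h')]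

lemma card_ker_conjMap {τ : L ≃ₐ[ℚ] L} (h : W.map (τ : L →+* L) = V)
    (h' : W'.map (τ : L →+* L) = V') (φ : W.toAffine.Point →+ W'.toAffine.Point) :
    Nat.card (conjMap τ h h' φ).ker = Nat.card φ.ker := by
  rw [ker_conjMap, AddSubgroup.card_map_of_injective (conjHom_injective h)]

lemma conjMap_comp {τ : L ≃ₐ[ℚ] L} (h : W.map (τ : L →+* L) = V)
    (h' : W'.map (τ : L →+* L) = V') (h'' : W''.map (τ : L →+* L) = V'')
    (ψ : W'.toAffine.Point →+ W''.toAffine.Point) (φ : W.toAffine.Point →+ W'.toAffine.Point) :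
    conjMap τ h h'' (ψ.comp φ) = (conjMap τ h' h'' ψ).comp (conjMap τ h h' φ) := by
  ext Q
  obtain ⟨P, rfl⟩ := conjHom_surjective h Q
  simp only [AddMonoidHom.comp_apply, conjMap_conjHom]

lemma conjMap_conjMap {τ τ' : L ≃ₐ[ℚ] L} (h : W.map (τ : L →+* L) = V)
    (h' : W'.map (τ : L →+* L) = V') (g : V.map (τ' : L →+* L) = U)
    (g' : V'.map (τ' : L →+* L) = U') (φ : W.toAffine.Point →+ W'.toAffine.Point) :
    conjMap τ' g g' (conjMap τ h h' φ) =
      conjMap (τ' * τ) (map_mul_eq h g) (map_mul_eq h' g') φ := by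
  ext Q
  obtain ⟨Q, rfl⟩ := conjHom_surjective g Q
  obtain ⟨P, rfl⟩ := conjHom_surjective h Q
  rw [conjMap_conjHom, conjMap_conjHom, conjHom_conjHom h g (map_mul_eq h g), conjMap_conjHom,
    conjHom_conjHom h' g' (map_mul_eq h' g')]

lemma conjMap_zsmul {τ : L ≃ₐ[ℚ] L} (h : W.map (τ : L →+* L) = V) (m : ℤ) :
    conjMap τ h h (zsmulAddGroupHom m) = zsmulAddGroupHom m := by
  ext Q
  obtain ⟨P, rfl⟩ := conjHom_surjective h Q
  rw [conjMap_conjHom, zsmulAddGroupHom_apply, zsmulAddGroupHom_apply, map_zsmul]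

/-- Applying τ to the formulas for φ at P gives the formulas with conjugate coefficients at τ(P), so
new exceptional points come from old ones. -/
lemma finite_conj_bad {k : Type*} [Field k] [Algebra k L] {τ : L ≃ₐ[ℚ] L}
    (h : W.map (τ : L →+* L) = V) (h' : W'.map (τ : L →+* L) = V')
    {φ : W.toAffine.Point →+ W'.toAffine.Point} {a b c : MvPolynomial (Fin 2) k}
    (hfin : {P : W.toAffine.Point | ¬ ∃ (x y : L) (h : W.toAffine.Nonsingular x y)
        (u v : L) (h' : W'.toAffine.Nonsingular u v),
        P = .some x y h ∧ φ P = .some u v h' ∧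
        MvPolynomial.aeval ![x, y] c ≠ 0 ∧
        u = MvPolynomial.aeval ![x, y] a / MvPolynomial.aeval ![x, y] c ∧
        v = MvPolynomial.aeval ![x, y] b / MvPolynomial.aeval ![x, y] c}.Finite) :
    {P : V.toAffine.Point | ¬ ∃ (x y : L) (h₁ : V.toAffine.Nonsingular x y)
        (u v : L) (h₂ : V'.toAffine.Nonsingular u v),
        P = .some x y h₁ ∧ conjMap τ h h' φ P = .some u v h₂ ∧
        MvPolynomial.aeval ![x, y] (c.map ((τ : L →+* L).comp (algebraMap k L))) ≠ 0 ∧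
        u = MvPolynomial.aeval ![x, y] (a.map ((τ : L →+* L).comp (algebraMap k L))) /
          MvPolynomial.aeval ![x, y] (c.map ((τ : L →+* L).comp (algebraMap k L))) ∧
        v = MvPolynomial.aeval ![x, y] (b.map ((τ : L →+* L).comp (algebraMap k L))) /
          MvPolynomial.aeval ![x, y] (c.map ((τ : L →+* L).comp (algebraMap k L)))}.Finite := by
  refine (hfin.image (conjHom τ h)).subset fun Q hQ => ?_
  obtain ⟨P, rfl⟩ := conjHom_surjective h Q
  refine ⟨P, fun hP => hQ ?_, rfl⟩
  obtain ⟨x, y, h1, u, v, h2, h3, h4, h5, h6, h7⟩ := hP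
  have e1 : ∃ h₁, conjHom τ h P = .some (τ x) (τ y) h₁ := by rw [h3]; exact ⟨_, rfl⟩
  have e2 : ∃ h₂, conjMap τ h h' φ (conjHom τ h P) = .some (τ u) (τ v) h₂ := by
    rw [conjMap_conjHom, h4]; exact ⟨_, rfl⟩
  obtain ⟨h₁, e1⟩ := e1
  obtain ⟨h₂, e2⟩ := e2
  refine ⟨_, _, h₁, _, _, h₂, e1, e2, ?_, ?_, ?_⟩
  · rw [aeval_map_conj]
    simpa using h5
  · rw [aeval_map_conj, aeval_map_conj, h6, map_div₀]
  · rw [aeval_map_conj, aeval_map_conj, h7, map_div₀]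

lemma IsIsogeny.conjMap {τ : L ≃ₐ[ℚ] L} (h : W.map (τ : L →+* L) = V)
    (h' : W'.map (τ : L →+* L) = V') {φ : W.toAffine.Point →+ W'.toAffine.Point}
    (hφ : IsIsogeny L φ) : IsIsogeny L (conjMap τ h h' φ) := by
  obtain ⟨a, b, c, hfin⟩ := hφ
  exact ⟨_, _, _, finite_conj_bad h h' hfin⟩

/-- The conjugate of an isogeny over `k` depends only on the restriction of `τ` to `k`. -/
lemma IsIsogeny.conjMap_eq_conjMap [IsAlgClosed L] [V.IsElliptic] {k : Type*} [Field k]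
    [Algebra k L] {τ τ' : L ≃ₐ[ℚ] L}
    (hτ : ∀ a : k, τ (algebraMap k L a) = τ' (algebraMap k L a))
    (h : W.map (τ : L →+* L) = V) (h' : W'.map (τ : L →+* L) = V')
    (g : W.map (τ' : L →+* L) = V) (g' : W'.map (τ' : L →+* L) = V')
    {φ : W.toAffine.Point →+ W'.toAffine.Point} (hφ : IsIsogeny k φ) :
    QuadQCurve.conjMap τ h h' φ = QuadQCurve.conjMap τ' g g' φ := by
  obtain ⟨a, b, c, hfin⟩ := hφ
  have := infinite_point V
  -- Both conjugates are given by the same formulas off finite sets, and homomorphisms agreeing at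
  -- almost all points are equal.
  have hcomp : (τ : L →+* L).comp (algebraMap k L) = (τ' : L →+* L).comp (algebraMap k L) :=
    RingHom.ext hτ
  have h1 := finite_conj_bad h h' hfin
  have h2 := finite_conj_bad g g' hfin
  rw [← hcomp] at h2
  refine hom_ext_of_eventually_eq ?_
  filter_upwards [eventually_cofinite.mpr h1, eventually_cofinite.mpr h2]
  rintro _ ⟨x, y, h3, u, v, h4, rfl, h5, h6, h7, h8⟩
    ⟨x', y', h3', u', v', h4', h0, h5', h6', h7', h8'⟩
  obtain ⟨rfl, rfl⟩ := Affine.Point.some.inj h0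
  rw [h5, h5', Affine.Point.some.injEq]
  exact ⟨h7.trans h7'.symm, h8.trans h8'.symm⟩

lemma conjMap_of_fixed {τ : L ≃ₐ[ℚ] L} (hτ : ∀ a, τ a = a) (h : W.map (τ : L →+* L) = W)
    (h' : W'.map (τ : L →+* L) = W') (φ : W.toAffine.Point →+ W'.toAffine.Point) :
    conjMap τ h h' φ = φ := by
  have hid : ∀ {U : WeierstrassCurve L} (hU : U.map (τ : L →+* L) = U) (P : U.toAffine.Point),
      conjHom τ hU P = P := by
    rintro U hU (_ | ⟨x, y, hxy⟩)
    · rfl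
    · change Affine.Point.some (τ x) (τ y) _ = _
      simp [hτ]
  ext P
  conv_lhs => rw [← hid h P]
  rw [conjMap_conjHom, hid]

/-- An isogeny over `k` commutes with the automorphisms fixing `k`. -/
lemma IsIsogeny.conjMap_eq_self [IsAlgClosed L] [W.IsElliptic] {k : Type*} [Field k]
    [Algebra k L] {τ : L ≃ₐ[ℚ] L} (hτ : ∀ a : k, τ (algebraMap k L a) = algebraMap k L a)
    (h : W.map (τ : L →+* L) = W) (h' : W'.map (τ : L →+* L) = W')
    {φ : W.toAffine.Point →+ W'.toAffine.Point} (hφ : IsIsogeny k φ) :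
    QuadQCurve.conjMap τ h h' φ = φ := by
  have hone : ∀ U : WeierstrassCurve L, U.map ((1 : L ≃ₐ[ℚ] L) : L →+* L) = U := fun U => by
    convert U.map_id
    rfl
  rw [hφ.conjMap_eq_conjMap (τ' := 1) (fun a => by simpa using hτ a) h h' (hone W) (hone W'),
    conjMap_of_fixed fun _ => rfl]

end Conjugation

/-! ### Criteria for a conjugate level pair to be x or its Atkin–Lehner image. -/

section LevelPairs

variable {L : Type*} [Field L] [DecidableEq L] [CharZero L] {n : ℕ}

lemma LevelPair.conj_iso_of_map_eq [IsAlgClosed L] (x : LevelPair L n) {τ : L ≃ₐ[ℚ] L}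
    (h : x.curve.map (τ : L →+* L) = x.curve)
    (hsub : x.subgroup.map (conjHom τ h) = x.subgroup) :
    (x.conj (τ : L →+* L)).Iso x := by
  -- The required isomorphism is the identity, transported along an equality of curves that is only
  -- propositional.
  have key : ∀ {W V : WeierstrassCurve L} [W.IsElliptic] (h : W = V), ∃ e : W.toAffine.Point ≃+
      V.toAffine.Point, IsIsogeny L e.toAddMonoidHom ∧ IsIsogeny L e.symm.toAddMonoidHom ∧
      ∀ (U : WeierstrassCurve L) (τ : L ≃ₐ[ℚ] L) (hU : U.map (τ : L →+* L) = W) (P),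
        e (conjHom τ hU P) = conjHom τ (hU.trans h) P := by
    rintro W _ _ rfl
    have hid : IsIsogeny L (AddMonoidHom.id W.toAffine.Point) := by
      convert isIsogeny_one W
      ext P
      simp
    exact ⟨.refl _, hid, hid, fun _ _ _ _ => rfl⟩
  obtain ⟨e, h1, h2, h3⟩ := key h
  have hmap : (x.subgroup.map (conjPoint (τ : L →+* L) x.curve)).map e.toAddMonoidHom =
      x.subgroup := by
    rw [AddSubgroup.map_map, ← conjHom_rfl]
    refine Eq.trans ?_ hsub
    congr 1
    ext P
    exact h3 _ _ rfl P
  exact ⟨e, h1, h2, hmap⟩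

lemma LevelPair.isAtkinLehnerImage_conj (x : LevelPair L n) {τ : L ≃ₐ[ℚ] L}
    {V : WeierstrassCurve L} (h : x.curve.map (τ : L →+* L) = V) {d : ℕ}
    {μ : x.curve.toAffine.Point →+ V.toAffine.Point} (hμ : IsIsogeny L μ)
    (hker : μ.ker = x.subgroup ⊓ AddSubgroup.torsionBy x.curve.toAffine.Point (d : ℤ))
    (hsub : x.subgroup.map (conjHom τ h) =
      (AddSubgroup.torsionBy x.curve.toAffine.Point (d : ℤ)).map μ ⊔
        (x.subgroup ⊓
          AddSubgroup.torsionBy x.curve.toAffine.Point ((n / d : ℕ) : ℤ)).map μ) :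
    x.IsAtkinLehnerImage d (x.conj (τ : L →+* L)) := by
  subst h
  rw [conjHom_rfl] at hsub
  exact ⟨μ, hμ, hker, hsub⟩

end LevelPairs

/-! ### Cyclic subgroups of coprime orders. -/

section GroupTheory

variable {A B : Type*} [AddCommGroup A] [AddCommGroup B]

lemma mem_torsionBy {n : ℤ} {a : A} : a ∈ AddSubgroup.torsionBy A n ↔ n • a = 0 := Iff.rfl

/-- As f is surjective, ker g consists of the f(a) with na = 0. This identifies the kernel of a
conjugate isogeny with the image of torsion in the Atkin–Lehner involution. -/
lemma ker_eq_map_torsionBy {f : A →+ B} (hf : Function.Surjective f) {g : B →+ A} {n : ℤ}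
    (h : (∀ a, g (f a) = n • a) ∨ ∀ a, g (f a) = (-n) • a) :
    g.ker = (AddSubgroup.torsionBy A n).map f := by
  ext b
  obtain ⟨a, rfl⟩ := hf b
  have h' : ∀ a, g (f a) = 0 ↔ n • a = 0 := fun a => by
    rcases h with h | h <;> simp [h]
  rw [AddMonoidHom.mem_ker, AddSubgroup.mem_map, h']
  constructor
  · exact fun ha => ⟨a, ha, rfl⟩
  · rintro ⟨a', ha', h2⟩
    rw [← h', ← h2, h']
    exact ha'

lemma exists_zmultiples_eq_of_isAddCyclic {H : AddSubgroup A} (hc : IsAddCyclic H) :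
    ∃ a, H = AddSubgroup.zmultiples a ∧ addOrderOf a = Nat.card H := by
  obtain ⟨⟨a, ha⟩, h⟩ := hc.exists_generator
  have hH : H = AddSubgroup.zmultiples a := by
    refine le_antisymm (fun b hb => ?_) (AddSubgroup.zmultiples_le_of_mem ha)
    obtain ⟨z, hz⟩ := AddSubgroup.mem_zmultiples_iff.mp (h ⟨b, hb⟩)
    exact AddSubgroup.mem_zmultiples_iff.mpr ⟨z, congrArg Subtype.val hz⟩
  exact ⟨a, hH, by rw [hH, Nat.card_zmultiples]⟩

lemma isAddCyclic_of_mem_of_coprime {H : AddSubgroup A} {a b : A} (ha : a ∈ H) (hb : b ∈ H)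
    (hco : (addOrderOf a).Coprime (addOrderOf b))
    (hcard : Nat.card H = addOrderOf a * addOrderOf b) (h0 : Nat.card H ≠ 0) :
    IsAddCyclic H := by
  have : Finite H := Nat.finite_of_card_ne_zero h0
  refine isAddCyclic_of_addOrderOf_eq_card (⟨a + b, H.add_mem ha hb⟩ : H) ?_
  rw [AddSubgroup.addOrderOf_mk, hcard]
  exact (AddCommute.all a b).addOrderOf_add_eq_mul_addOrderOf_of_coprime hco

lemma zmultiples_sup_zmultiples {a b : A} (hco : (addOrderOf a).Coprime (addOrderOf b)) :
    AddSubgroup.zmultiples a ⊔ AddSubgroup.zmultiples b = AddSubgroup.zmultiples (a + b) := by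
  obtain ⟨u, v, huv⟩ := Nat.isCoprime_iff_coprime.mpr hco
  have hza : (addOrderOf a : ℤ) • a = 0 := by rw [natCast_zsmul, addOrderOf_nsmul_eq_zero]
  have hzb : (addOrderOf b : ℤ) • b = 0 := by rw [natCast_zsmul, addOrderOf_nsmul_eq_zero]
  refine le_antisymm (sup_le ?_ ?_) (AddSubgroup.zmultiples_le_of_mem
    (add_mem (AddSubgroup.mem_sup_left (AddSubgroup.mem_zmultiples a))
      (AddSubgroup.mem_sup_right (AddSubgroup.mem_zmultiples b))))
  · refine AddSubgroup.zmultiples_le_of_mem (AddSubgroup.mem_zmultiples_iff.mpr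
      ⟨v * addOrderOf b, ?_⟩)
    have : v * (addOrderOf b : ℤ) = 1 - u * addOrderOf a := by linear_combination huv
    rw [zsmul_add, mul_zsmul b, hzb, zsmul_zero, add_zero, this, sub_zsmul, one_zsmul,
      mul_zsmul a, hza, zsmul_zero, neg_zero, add_zero]
  · refine AddSubgroup.zmultiples_le_of_mem (AddSubgroup.mem_zmultiples_iff.mpr
      ⟨u * addOrderOf a, ?_⟩)
    have : u * (addOrderOf a : ℤ) = 1 - v * addOrderOf b := by linear_combination huv
    rw [zsmul_add, mul_zsmul a, hza, zsmul_zero, zero_add, this, sub_zsmul, one_zsmul,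
      mul_zsmul b, hzb, zsmul_zero, neg_zero, add_zero]

/-- Multiplication by the order of a kills the first summand and is injective on the second. This
recovers C_d and C_m from their sum. -/
lemma zmultiples_sup_inf_torsionBy {a b : A}
    (hco : (addOrderOf a).Coprime (addOrderOf b)) :
    (AddSubgroup.zmultiples a ⊔ AddSubgroup.zmultiples b) ⊓
      AddSubgroup.torsionBy A (addOrderOf a : ℤ) = AddSubgroup.zmultiples a := by
  refine le_antisymm ?_ (le_inf le_sup_left ?_)
  · rintro x ⟨hx, hx'⟩
    obtain ⟨_, ⟨i, rfl⟩, _, ⟨j, rfl⟩, rfl⟩ := AddSubgroup.mem_sup.mp hx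
    have h1 : ((addOrderOf a : ℤ) * j) • b = 0 := by
      have : (addOrderOf a : ℤ) • (i • a + j • b) = 0 := hx'
      rwa [zsmul_add, smul_comm, natCast_zsmul, addOrderOf_nsmul_eq_zero, zsmul_zero, zero_add,
        smul_smul] at this
    have h2 : (addOrderOf b : ℤ) ∣ j :=
      (Nat.isCoprime_iff_coprime.mpr hco.symm).dvd_of_dvd_mul_left
        (addOrderOf_dvd_iff_zsmul_eq_zero.mpr h1)
    have h3 : j • b = 0 := addOrderOf_dvd_iff_zsmul_eq_zero.mp h2
    exact ⟨i, by simp [h3]⟩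
  · rintro _ ⟨i, rfl⟩
    change (addOrderOf a : ℤ) • i • a = 0
    rw [smul_comm, natCast_zsmul, addOrderOf_nsmul_eq_zero, zsmul_zero]

end GroupTheory

/-! ### Consequences of the absence of complex multiplication. -/

section NonCM

variable {L : Type*} [Field L] [DecidableEq L] [CharZero L] [IsAlgClosed L]
  {W V : WeierstrassCurve L} [W.IsElliptic] [V.IsElliptic]

lemma card_ker_zsmul (n : ℤ) :
    Nat.card (zsmulAddGroupHom n : W.toAffine.Point →+ W.toAffine.Point).ker = n.natAbs ^ 2 := by
  rw [← card_torsion W]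
  congr 2
  ext P
  rcases Int.natAbs_eq n with h | h <;> rw [h] <;> simp [AddMonoidHom.mem_ker]

/-- The composite is some [n], and comparing degrees gives n² = d². -/
lemma comp_eq_smul_of_nonCM
    (hCM : ∀ φ : W.toAffine.Point →+ W.toAffine.Point, IsIsogeny L φ →
      ∃ n : ℤ, ∀ P, φ P = n • P)
    {d : ℕ} {α : W.toAffine.Point →+ V.toAffine.Point}
    {β : V.toAffine.Point →+ W.toAffine.Point} (hα : IsIsogeny L α) (hβ : IsIsogeny L β)
    (hdα : Nat.card α.ker = d) (hdβ : Nat.card β.ker = d) :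
    (∀ P, β (α P) = (d : ℤ) • P) ∨ ∀ P, β (α P) = (-d : ℤ) • P := by
  obtain ⟨n, hn⟩ := hCM _ (hβ.comp hα)
  have h1 : β.comp α = zsmulAddGroupHom n := AddMonoidHom.ext hn
  have h2 := card_ker_comp β hα.surjective
  rw [h1, card_ker_zsmul, hdα, hdβ, ← sq] at h2
  have h3 : n.natAbs = d := Nat.pow_left_injective two_ne_zero h2
  rcases Int.natAbs_eq n with h | h <;> rw [h3] at h <;> subst h
  exacts [Or.inl hn, Or.inr hn]

/-- Both composites with β are ±d, so β kills α' - α or α' + α. That map has values in a group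
killed by d, while W is d-divisible, so it is zero. -/
lemma eq_or_eq_neg_of_nonCM
    (hCM : ∀ φ : W.toAffine.Point →+ W.toAffine.Point, IsIsogeny L φ →
      ∃ n : ℤ, ∀ P, φ P = n • P)
    {d : ℕ} (hd : 0 < d) {α α' : W.toAffine.Point →+ V.toAffine.Point}
    {β : V.toAffine.Point →+ W.toAffine.Point} (hα : IsIsogeny L α) (hα' : IsIsogeny L α')
    (hβ : IsIsogeny L β) (hdα : Nat.card α.ker = d) (hdα' : Nat.card α'.ker = d)
    (hdβ : Nat.card β.ker = d) : α' = α ∨ α' = -α := by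
  have key : ∀ γ : W.toAffine.Point →+ V.toAffine.Point, (∀ P, β (γ P) = 0) → γ = 0 := by
    intro γ hγ
    ext P
    obtain ⟨Q, rfl⟩ := (isIsogeny_natCast W hd).surjective P
    have h1 : d • (⟨γ Q, hγ Q⟩ : β.ker) = 0 := by
      rw [← hdβ]
      exact card_nsmul_eq_zero'
    rw [zsmulAddGroupHom_apply, map_zsmul, natCast_zsmul, AddMonoidHom.zero_apply]
    exact congrArg Subtype.val h1
  rcases comp_eq_smul_of_nonCM hCM hα hβ hdα hdβ with h | h <;>
    rcases comp_eq_smul_of_nonCM hCM hα' hβ hdα' hdβ with h' | h'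
  · exact Or.inl (sub_eq_zero.mp (key _ fun P => by simp [h, h']))
  · exact Or.inr (eq_neg_of_add_eq_zero_left (key _ fun P => by simp [h, h']))
  · exact Or.inr (eq_neg_of_add_eq_zero_left (key _ fun P => by simp [h, h']))
  · exact Or.inl (sub_eq_zero.mp (key _ fun P => by simp [h, h']))

end NonCM

/-! ### Automorphisms of L restricting to a given one of the subfield. -/

section GaloisAction

variable {L : Type*} [Field L] [CharZero L] {k : Type*} [Field k] [CharZero k] [Algebra k L]

/-- `τ` restricts to `σ` on the subfield `k`. -/
def ActsAs (σ : k ≃ₐ[ℚ] k) (τ : L ≃ₐ[ℚ] L) : Prop :=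
  ∀ a : k, τ (algebraMap k L a) = algebraMap k L (σ a)

lemma ActsAs.mul {σ σ' : k ≃ₐ[ℚ] k} {τ τ' : L ≃ₐ[ℚ] L} (h : ActsAs σ τ) (h' : ActsAs σ' τ') :
    ActsAs (σ * σ') (τ * τ') := fun a => by
  rw [AlgEquiv.mul_apply, AlgEquiv.mul_apply, h' a, h]

lemma ActsAs.map_eq {σ : k ≃ₐ[ℚ] k} {τ : L ≃ₐ[ℚ] L} (h : ActsAs σ τ) (E : WeierstrassCurve k) :
    (E.baseChange L).map (τ : L →+* L) = (E.map (σ : k →+* k)).baseChange L := by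
  change (E.map _).map _ = (E.map _).map _
  rw [WeierstrassCurve.map_map, WeierstrassCurve.map_map]
  congr 1
  exact RingHom.ext h

/-- `W` and `V` are defined over `k` and interchanged by `σ`. -/
structure Conjugates (σ : k ≃ₐ[ℚ] k) (W V : WeierstrassCurve L) : Prop where
  fix {τ : L ≃ₐ[ℚ] L} : ActsAs (1 : k ≃ₐ[ℚ] k) τ → W.map (τ : L →+* L) = W
  fix' {τ : L ≃ₐ[ℚ] L} : ActsAs (1 : k ≃ₐ[ℚ] k) τ → V.map (τ : L →+* L) = V
  swap {τ : L ≃ₐ[ℚ] L} : ActsAs σ τ → W.map (τ : L →+* L) = V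
  swap' {τ : L ≃ₐ[ℚ] L} : ActsAs σ τ → V.map (τ : L →+* L) = W

lemma conjugates_baseChange {σ : k ≃ₐ[ℚ] k} (hσ : σ * σ = 1) (E : WeierstrassCurve k) :
    Conjugates σ (E.baseChange L) ((E.map (σ : k →+* k)).baseChange L) where
  fix h := (h.map_eq E).trans (congrArg (fun E : WeierstrassCurve k => E.baseChange L) E.map_id)
  fix' h := (h.map_eq _).trans
    (congrArg (fun E : WeierstrassCurve k => E.baseChange L) (E.map (σ : k →+* k)).map_id)
  swap h := h.map_eq E
  swap' h := (h.map_eq _).trans (by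
    rw [WeierstrassCurve.map_map]
    have : (σ : k →+* k).comp (σ : k →+* k) = RingHom.id k :=
      RingHom.ext fun a => DFunLike.congr_fun hσ a
    rw [this, WeierstrassCurve.map_id])

end GaloisAction

/-! ### Construction of the rational points. -/

section Main

variable {L : Type*} [Field L] [DecidableEq L] [CharZero L] [IsAlgClosed L]
  {k : Type*} [Field k] [CharZero k] [Algebra k L] {σ : k ≃ₐ[ℚ] k}
  {W W' V V' : WeierstrassCurve L} [W.IsElliptic] [V.IsElliptic]

lemma Conjugates.conjMap_mu (hC : Conjugates σ W V)
    (hCM : ∀ φ : W.toAffine.Point →+ W.toAffine.Point, IsIsogeny L φ →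
      ∃ n : ℤ, ∀ P, φ P = n • P)
    {d : ℕ} {μ : W.toAffine.Point →+ V.toAffine.Point} (hμ : IsIsogeny L μ)
    (hμd : Nat.card μ.ker = d) {τ : L ≃ₐ[ℚ] L} (hτ : ActsAs σ τ) :
    (∀ P, conjMap τ (hC.swap hτ) (hC.swap' hτ) μ (μ P) = (d : ℤ) • P) ∨
      ∀ P, conjMap τ (hC.swap hτ) (hC.swap' hτ) μ (μ P) = (-d : ℤ) • P :=
  comp_eq_smul_of_nonCM hCM hμ (hμ.conjMap _ _) hμd ((card_ker_conjMap _ _ _).trans hμd)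

/-- The conjugate of μ by τ₀ runs from V back to W and serves as the return map β. -/
lemma Conjugates.conjMap_mu_fix (hC : Conjugates σ W V)
    (hCM : ∀ φ : W.toAffine.Point →+ W.toAffine.Point, IsIsogeny L φ →
      ∃ n : ℤ, ∀ P, φ P = n • P)
    {d : ℕ} (hd : 0 < d) {μ : W.toAffine.Point →+ V.toAffine.Point} (hμ : IsIsogeny L μ)
    (hμd : Nat.card μ.ker = d) {τ₀ : L ≃ₐ[ℚ] L} (hτ₀ : ActsAs σ τ₀) {ρ : L ≃ₐ[ℚ] L}
    (hρ : ActsAs (1 : k ≃ₐ[ℚ] k) ρ) :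
    conjMap ρ (hC.fix hρ) (hC.fix' hρ) μ = μ ∨ conjMap ρ (hC.fix hρ) (hC.fix' hρ) μ = -μ :=
  eq_or_eq_neg_of_nonCM hCM hd hμ (hμ.conjMap _ _)
    (hμ.conjMap (hC.swap hτ₀) (hC.swap' hτ₀)) hμd ((card_ker_conjMap _ _ _).trans hμd)
    ((card_ker_conjMap _ _ _).trans hμd)

/-- The case in which `μ` maps the kernel of `φ` to that of its conjugate. -/
lemma exists_levelPair_of_map_ker_eq (hC : Conjugates σ W V) (hC' : Conjugates σ W' V')
    (hsplit : ∀ τ : L ≃ₐ[ℚ] L, ActsAs (1 : k ≃ₐ[ℚ] k) τ ∨ ActsAs σ τ)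
    {τ₀ : L ≃ₐ[ℚ] L} (hτ₀ : ActsAs σ τ₀)
    (hCM : ∀ φ : W.toAffine.Point →+ W.toAffine.Point, IsIsogeny L φ →
      ∃ n : ℤ, ∀ P, φ P = n • P)
    {d : ℕ} (hd : 0 < d) {μ : W.toAffine.Point →+ V.toAffine.Point} (hμ : IsIsogeny L μ)
    (hμd : HasCyclicKernel μ d) {m : ℕ} (hm : 0 < m) (hco : m.Coprime d)
    {φ : W.toAffine.Point →+ W'.toAffine.Point}
    (hφ : IsIsogeny k φ) (hφm : HasCyclicKernel φ m)
    (hmap : φ.ker.map μ = (conjMap τ₀ (hC.swap hτ₀) (hC'.swap hτ₀) φ).ker) :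
    ∃ x : LevelPair L (m * d), x.curve.j = W.j ∧ x.IsRationalModAtkinLehner d := by
  obtain ⟨a, ha, hao⟩ := exists_zmultiples_eq_of_isAddCyclic hμd.1
  obtain ⟨b, hb, hbo⟩ := exists_zmultiples_eq_of_isAddCyclic hφm.1
  rw [hμd.2] at hao
  rw [hφm.2] at hbo
  have hcop : (addOrderOf a).Coprime (addOrderOf b) := by rw [hao, hbo]; exact hco.symm
  have hcard : Nat.card (μ.ker ⊔ φ.ker : AddSubgroup W.toAffine.Point) = m * d := by
    rw [ha, hb, zmultiples_sup_zmultiples hcop, Nat.card_zmultiples,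
      (AddCommute.all a b).addOrderOf_add_eq_mul_addOrderOf_of_coprime hcop,
      hao, hbo, mul_comm]
  have hcyc : IsAddCyclic (μ.ker ⊔ φ.ker : AddSubgroup W.toAffine.Point) :=
    isAddCyclic_of_mem_of_coprime
      (AddSubgroup.mem_sup_left (ha ▸ AddSubgroup.mem_zmultiples a))
      (AddSubgroup.mem_sup_right (hb ▸ AddSubgroup.mem_zmultiples b)) hcop
      (by rw [hcard, hao, hbo, mul_comm]) (by rw [hcard]; positivity)
  have hinfd : (μ.ker ⊔ φ.ker) ⊓ AddSubgroup.torsionBy W.toAffine.Point (d : ℤ) = μ.ker := by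
    rw [ha, hb, ← hao]
    exact zmultiples_sup_inf_torsionBy hcop
  have hinfm : (μ.ker ⊔ φ.ker) ⊓ AddSubgroup.torsionBy W.toAffine.Point (m : ℤ) = φ.ker := by
    rw [ha, hb, ← hbo, sup_comm]
    exact zmultiples_sup_inf_torsionBy hcop.symm
  let x : LevelPair L (m * d) := ⟨W, inferInstance, μ.ker ⊔ φ.ker, hcyc, hcard⟩
  refine ⟨x, rfl, fun τ => ?_⟩
  rcases hsplit τ with hτ | hτ
  -- Automorphisms over k preserve ker φ, since φ is defined over k, and ker μ, since μ changes at
  -- most by a sign.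
  · refine Or.inl (x.conj_iso_of_map_eq (hC.fix hτ) ?_)
    change (μ.ker ⊔ φ.ker).map _ = μ.ker ⊔ φ.ker
    rw [AddSubgroup.map_sup, ← ker_conjMap (hC.fix hτ) (hC.fix' hτ),
      ← ker_conjMap (hC.fix hτ) (hC'.fix hτ), hφ.conjMap_eq_self hτ]
    rcases hC.conjMap_mu_fix hCM hd hμ hμd.2 hτ₀ hτ with h | h <;> rw [h]
    congr 1
    ext P
    simp [AddMonoidHom.mem_ker]
  -- Here μ itself realises w_d: the conjugate of ker μ is μ(W[d]) because μ^τ ∘ μ = ±d, and the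
  -- conjugate of ker φ is μ(ker φ).
  · refine Or.inr (x.isAtkinLehnerImage_conj (hC.swap hτ) hμ hinfd.symm ?_)
    change (μ.ker ⊔ φ.ker).map _ = _ ⊔ ((μ.ker ⊔ φ.ker) ⊓ _).map μ
    rw [Nat.mul_div_cancel _ hd, hinfm, AddSubgroup.map_sup, hmap,
      ← ker_conjMap (hC.swap hτ) (hC.swap' hτ), ← ker_conjMap (hC.swap hτ) (hC'.swap hτ),
      hφ.conjMap_eq_conjMap (fun c => (hτ c).trans (hτ₀ c).symm) (hC.swap hτ) (hC'.swap hτ)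
        (hC.swap hτ₀) (hC'.swap hτ₀)]
    congr 1
    exact ker_eq_map_torsionBy hμ.surjective (hC.conjMap_mu hCM hμ hμd.2 hτ)

/-- The case in which `W'` is a `ℚ`-curve of degree `m² d`. -/
lemma exists_levelPair_of_addOrderOf [W'.IsElliptic] [V'.IsElliptic]
    (hC : Conjugates σ W V) (hC' : Conjugates σ W' V')
    (hσ : σ * σ = 1) (hsplit : ∀ τ : L ≃ₐ[ℚ] L, ActsAs (1 : k ≃ₐ[ℚ] k) τ ∨ ActsAs σ τ)
    {τ₀ : L ≃ₐ[ℚ] L} (hτ₀ : ActsAs σ τ₀)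
    (hCM : ∀ φ : W.toAffine.Point →+ W.toAffine.Point, IsIsogeny L φ →
      ∃ n : ℤ, ∀ P, φ P = n • P)
    {d : ℕ} (hd : 0 < d) {μ : W.toAffine.Point →+ V.toAffine.Point} (hμ : IsIsogeny L μ)
    (hμd : HasCyclicKernel μ d) {φ : W.toAffine.Point →+ W'.toAffine.Point}
    (hφ : IsIsogeny k φ) (hφco : d.Coprime (Nat.card φ.ker)) {m : ℕ} (hm : 0 < m)
    (hco : d.Coprime (m ^ 2))
    (hkill : ∀ P ∈ φ.ker, conjMap τ₀ (hC.swap hτ₀) (hC'.swap hτ₀) φ (μ ((m : ℤ) • P)) = 0)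
    {Q : W.toAffine.Point}
    (hQ : conjMap τ₀ (hC.swap hτ₀) (hC'.swap hτ₀) φ (μ ((m : ℤ) • Q)) = 0)
    (hQo : addOrderOf (φ Q) = m ^ 2) :
    ∃ x : LevelPair L (m ^ 2 * d), x.curve.j = W'.j ∧ x.IsRationalModAtkinLehner (m ^ 2 * d) := by
  have hφL : IsIsogeny L φ := hφ.of_algebra
  have hφs := hφL.surjective
  set φ₀ := conjMap τ₀ (hC.swap hτ₀) (hC'.swap hτ₀) φ with hφ₀
  have hφ₀L : IsIsogeny L φ₀ := hφL.conjMap _ _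
  set h : W.toAffine.Point →+ V'.toAffine.Point :=
    φ₀.comp (μ.comp (zsmulAddGroupHom (m : ℤ))) with hh
  have hmL := isIsogeny_natCast W hm
  have hhL : IsIsogeny L h := hφ₀L.comp (hμ.comp hmL)
  obtain ⟨ψ, hψφ⟩ : ∃ ψ : W'.toAffine.Point →+ V'.toAffine.Point, ψ.comp φ = h :=
    ⟨φ.liftOfSurjective hφs ⟨h, hkill⟩, φ.liftOfRightInverse_comp _ _ ⟨h, hkill⟩⟩
  have hψφ' : ∀ P, ψ (φ P) = φ₀ (μ ((m : ℤ) • P)) := fun P => DFunLike.congr_fun hψφ P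
  have hψL : IsIsogeny L ψ := hφL.of_comp (hψφ ▸ hhL)
  have hcard : Nat.card ψ.ker = m ^ 2 * d := by
    have h1 := card_ker_comp ψ hφs
    rw [hψφ, hh, card_ker_comp _ (hμ.comp hmL).surjective, card_ker_comp _ hmL.surjective,
      card_torsion, hμd.2, hφ₀, card_ker_conjMap, mul_comm] at h1
    have : Finite φ.ker := hφL.finite_ker
    exact (Nat.eq_of_mul_eq_mul_left Nat.card_pos h1).symm
  obtain ⟨a, ha, hao⟩ := exists_zmultiples_eq_of_isAddCyclic hμd.1
  rw [hμd.2] at hao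
  -- The order of a is prime to that of ker φ, so φ preserves it.
  have hφa : addOrderOf (φ a) = d := by
    refine Nat.dvd_antisymm (hao ▸ addOrderOf_map_dvd φ a) ?_
    have h1 : addOrderOf (φ a) • a ∈ φ.ker := by
      rw [AddMonoidHom.mem_ker, map_nsmul, addOrderOf_nsmul_eq_zero]
    have h2 : Nat.card φ.ker • (⟨_, h1⟩ : φ.ker) = 0 := card_nsmul_eq_zero'
    have h3 : (Nat.card φ.ker * addOrderOf (φ a)) • a = 0 := by
      rw [mul_nsmul']
      exact congrArg Subtype.val h2
    have h4 := addOrderOf_dvd_of_nsmul_eq_zero h3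
    rw [hao] at h4
    exact hφco.dvd_of_dvd_mul_left h4
  have hcyc : IsAddCyclic ψ.ker := by
    refine isAddCyclic_of_mem_of_coprime (a := φ a) (b := φ Q) ?_ ?_ ?_ ?_ ?_
    · have haμ : a ∈ μ.ker := ha ▸ AddSubgroup.mem_zmultiples a
      rw [AddMonoidHom.mem_ker, hψφ', map_zsmul, haμ, zsmul_zero, map_zero]
    · rw [AddMonoidHom.mem_ker, hψφ', hQ]
    · rw [hφa, hQo]
      exact hco
    · rw [hφa, hQo, hcard, mul_comm]
    · rw [hcard]
      positivity
  let x : LevelPair L (m ^ 2 * d) := ⟨W', inferInstance, ψ.ker, hcyc, hcard⟩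
  have hkertors : ψ.ker ≤ AddSubgroup.torsionBy W'.toAffine.Point ((m ^ 2 * d : ℕ) : ℤ) := by
    intro P hP
    have h1 : Nat.card ψ.ker • (⟨P, hP⟩ : ψ.ker) = 0 := card_nsmul_eq_zero'
    rw [mem_torsionBy, natCast_zsmul, ← hcard]
    exact congrArg Subtype.val h1
  refine ⟨x, rfl, fun τ => ?_⟩
  rcases hsplit τ with hτ | hτ
  · refine Or.inl (x.conj_iso_of_map_eq (hC'.fix hτ) ?_)
    change ψ.ker.map _ = ψ.ker
    rw [← ker_conjMap (hC'.fix hτ) (hC'.fix' hτ)]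
    -- Both τ τ₀ and τ₀ restrict to σ on k, so they conjugate φ in the same way.
    have hφ₀τ : conjMap τ (hC.fix' hτ) (hC'.fix' hτ) φ₀ = φ₀ := by
      rw [hφ₀, conjMap_conjMap]
      refine hφ.conjMap_eq_conjMap (fun c => ?_) _ _ _ _
      rw [hτ.mul hτ₀ c, hτ₀ c, one_mul]
    have hcomp := congrArg (conjMap τ (hC.fix hτ) (hC'.fix' hτ)) hψφ
    rw [conjMap_comp (hC.fix hτ) (hC'.fix hτ) (hC'.fix' hτ), hφ.conjMap_eq_self hτ, hh,
      conjMap_comp (hC.fix hτ) (hC.fix' hτ) (hC'.fix' hτ),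
      conjMap_comp (hC.fix hτ) (hC.fix hτ) (hC.fix' hτ), conjMap_zsmul, hφ₀τ] at hcomp
    ext P
    obtain ⟨P, rfl⟩ := hφs P
    have hP := DFunLike.congr_fun hcomp P
    simp only [AddMonoidHom.comp_apply, zsmulAddGroupHom_apply] at hP
    rw [AddMonoidHom.mem_ker, AddMonoidHom.mem_ker, hP, hψφ']
    rcases hC.conjMap_mu_fix hCM hd hμ hμd.2 hτ₀ hτ with h | h <;> simp [h]
  · refine Or.inr (x.isAtkinLehnerImage_conj (hC'.swap hτ) hψL
      (inf_eq_left.mpr hkertors).symm ?_)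
    change ψ.ker.map _ = _ ⊔ (ψ.ker ⊓ _).map ψ
    -- For the full involution w_n the complementary part C_m is trivial, and only ψ(W'[n]) remains.
    have hbot : (ψ.ker ⊓ AddSubgroup.torsionBy W'.toAffine.Point
        ((m ^ 2 * d / (m ^ 2 * d) : ℕ) : ℤ)).map ψ = ⊥ := by
      rw [eq_bot_iff]
      rintro _ ⟨P, ⟨hP, -⟩, rfl⟩
      exact hP
    rw [hbot, sup_bot_eq, ← ker_conjMap (hC'.swap hτ) (hC'.swap' hτ)]
    have hφτ : conjMap τ (hC.swap hτ) (hC'.swap hτ) φ = φ₀ :=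
      hφ.conjMap_eq_conjMap (fun c => (hτ c).trans (hτ₀ c).symm) _ _ _ _
    have hφ₀τ : conjMap τ (hC.swap' hτ) (hC'.swap' hτ) φ₀ = φ := by
      rw [hφ₀, conjMap_conjMap]
      refine hφ.conjMap_eq_self (fun c => ?_) _ _
      rw [hτ.mul hτ₀ c, hσ]
      rfl
    have hcomp := congrArg (conjMap τ (hC.swap hτ) (hC'.swap' hτ)) hψφ
    rw [conjMap_comp (hC.swap hτ) (hC'.swap hτ) (hC'.swap' hτ), hφτ, hh,
      conjMap_comp (hC.swap hτ) (hC.swap' hτ) (hC'.swap' hτ),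
      conjMap_comp (hC.swap hτ) (hC.swap hτ) (hC.swap' hτ), conjMap_zsmul, hφ₀τ] at hcomp
    -- Together with μ^τ ∘ μ = ±d this gives ψ^τ ∘ ψ = ±m²d on the image of φ, which is everything.
    have hcomp' : ∀ P, conjMap τ (hC'.swap hτ) (hC'.swap' hτ) ψ (ψ (φ P)) =
        φ (((m : ℤ) * m) • conjMap τ (hC.swap hτ) (hC.swap' hτ) μ (μ P)) := by
      intro P
      have hP := DFunLike.congr_fun hcomp (μ ((m : ℤ) • P))
      simp only [AddMonoidHom.comp_apply, zsmulAddGroupHom_apply] at hP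
      rw [hψφ', hP]
      simp only [map_zsmul, mul_zsmul]
    refine ker_eq_map_torsionBy hψL.surjective ?_
    refine (hC.conjMap_mu hCM hμ hμd.2 hτ).imp ?_ ?_ <;>
    · intro hμτ P
      obtain ⟨P, rfl⟩ := hφs P
      rw [hcomp', hμτ, smul_smul, map_zsmul]
      congr 1
      push_cast
      ring

end Main

/-! ### The Galois group of a quadratic field and its action on L. -/

section QuadraticField

variable {K : Type*} [Field K] [NumberField K] {L : Type*} [Field L] [CharZero L] [Algebra K L]

lemma eq_one_or_eq_of_finrank_eq_two (hK : Module.finrank ℚ K = 2) {σ : K ≃ₐ[ℚ] K} (hσ : σ ≠ 1)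
    (ρ : K ≃ₐ[ℚ] K) : ρ = 1 ∨ ρ = σ := by
  classical
  have : Algebra.IsQuadraticExtension ℚ K := ⟨hK⟩
  have hcard : Nat.card (K ≃ₐ[ℚ] K) = 2 := by rw [IsGalois.card_aut_eq_finrank, hK]
  by_contra! h
  have h3 : ({1, σ, ρ} : Finset (K ≃ₐ[ℚ] K)).card = 3 := by
    rw [Finset.card_eq_three]
    exact ⟨1, σ, ρ, hσ.symm, h.1.symm, h.2.symm, rfl⟩
  have := Finset.card_le_univ ({1, σ, ρ} : Finset (K ≃ₐ[ℚ] K))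
  rw [h3, ← Nat.card_eq_fintype_card, hcard] at this
  omega

lemma actsAs_one_or_actsAs (hK : Module.finrank ℚ K = 2) {σ : K ≃ₐ[ℚ] K} (hσ : σ ≠ 1)
    (τ : L ≃ₐ[ℚ] L) : ActsAs (1 : K ≃ₐ[ℚ] K) τ ∨ ActsAs σ τ := by
  have : Algebra.IsQuadraticExtension ℚ K := ⟨hK⟩
  have h : ActsAs (τ.restrictNormal K) τ := fun a => (τ.restrictNormal_commutes K a).symm
  rcases eq_one_or_eq_of_finrank_eq_two hK hσ (τ.restrictNormal K) with h' | h' <;> rw [h'] at h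
  exacts [Or.inl h, Or.inr h]

lemma mul_self_eq_one_of_finrank_eq_two (hK : Module.finrank ℚ K = 2) (σ : K ≃ₐ[ℚ] K) :
    σ * σ = 1 := by
  by_cases hσ : σ = 1
  · simp [hσ]
  · rcases eq_one_or_eq_of_finrank_eq_two hK hσ (σ * σ) with h | h
    · exact h
    · exact absurd (mul_eq_left.mp h) hσ

end QuadraticField

lemma exists_actsAs {K : Type*} [Field K] [NumberField K] {L : Type*} [Field L] [CharZero L]
    [Algebra K L] [IsAlgClosure K L] (σ : K ≃ₐ[ℚ] K) : ∃ τ : L ≃ₐ[ℚ] L, ActsAs σ τ := by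
  have : IsAlgClosed L := IsAlgClosure.isAlgClosed K
  have : Algebra.IsAlgebraic K L := IsAlgClosure.isAlgebraic
  have : Algebra.IsAlgebraic ℚ L := Algebra.IsAlgebraic.trans ℚ K L
  have : IsAlgClosure ℚ L := ⟨inferInstance, inferInstance⟩
  have : Normal ℚ L := IsAlgClosure.normal ℚ L
  exact ⟨σ.liftNormal L, fun a => σ.liftNormal_commutes L a⟩

lemma isElliptic_baseChange {K : Type*} [Field K] (L : Type*) [Field L] [Algebra K L]
    (E : WeierstrassCurve K) [E.IsElliptic] : (E.baseChange L).IsElliptic :=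
  inferInstanceAs (E.map (algebraMap K L)).IsElliptic

/-! ### Elements of order four. -/

section FourTorsion

variable {A B : Type*} [AddCommGroup A] [AddCommGroup B]

/-- Any preimage q has 4q in the kernel, hence killed by d. As d² ≡ 1 mod 4, the multiple d²q is
still a preimage and is killed by 4. -/
lemma exists_four_torsion_lift {f : A →+ B} (hf : Function.Surjective f) {d : ℕ} (hd : Odd d)
    (hcard : Nat.card f.ker = d) {b : B} (hb : addOrderOf b = 4) :
    ∃ a, f a = b ∧ addOrderOf a = 4 := by
  obtain ⟨q, rfl⟩ := hf b
  have hb4 : 4 • f q = 0 := hb ▸ addOrderOf_nsmul_eq_zero (f q)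
  have hker : d • 4 • q = 0 := by
    have h1 : 4 • q ∈ f.ker := by rw [AddMonoidHom.mem_ker, map_nsmul, hb4]
    have h2 : Nat.card f.ker • (⟨_, h1⟩ : f.ker) = 0 := card_nsmul_eq_zero'
    rw [← hcard]
    exact congrArg Subtype.val h2
  obtain ⟨j, hj⟩ : ∃ j, d * d = j * 4 + 1 := by
    obtain ⟨i, rfl⟩ := hd
    exact ⟨i * i + i, by ring⟩
  have hfa : f ((d * d) • q) = f q := by
    rw [map_nsmul, hj, add_nsmul, one_nsmul, mul_nsmul', hb4, nsmul_zero, zero_add]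
  have h4 : 4 • (d * d) • q = 0 := by
    rw [← mul_nsmul', show 4 * (d * d) = d * (d * 4) by ring, mul_nsmul', mul_nsmul', hker,
      nsmul_zero]
  refine ⟨(d * d) • q, hfa, Nat.dvd_antisymm (addOrderOf_dvd_of_nsmul_eq_zero h4) ?_⟩
  rw [← hb, ← hfa]
  exact addOrderOf_map_dvd f _

/-- A cyclic group of order 4 has only one element of order 2. -/
lemma two_nsmul_eq_of_mem_zmultiples {a e : A} (ha : addOrderOf a = 4) (he : addOrderOf e = 4)
    (h : 2 • e ∈ AddSubgroup.zmultiples a) : 2 • a = 2 • e := by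
  obtain ⟨j, hj⟩ := AddSubgroup.mem_zmultiples_iff.mp h
  have ha4 : (4 : ℤ) • a = 0 := by
    have := addOrderOf_nsmul_eq_zero a
    rw [ha] at this
    exact_mod_cast this
  have he2 : 2 • e ≠ 0 := fun h0 => by
    have := addOrderOf_dvd_of_nsmul_eq_zero h0
    rw [he] at this
    omega
  have hdvd : (4 : ℤ) ∣ 2 * j := by
    have : ((addOrderOf a : ℕ) : ℤ) ∣ 2 * j := by
      rw [addOrderOf_dvd_iff_zsmul_eq_zero, mul_comm, mul_zsmul', hj]
      have := addOrderOf_nsmul_eq_zero e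
      rw [he, show 4 = 2 * 2 from rfl, mul_nsmul'] at this
      exact_mod_cast this
    rwa [ha] at this
  have hne : ¬ (4 : ℤ) ∣ j := by
    rintro ⟨l, rfl⟩
    rw [mul_comm, mul_zsmul, ha4, zsmul_zero] at hj
    exact he2 hj.symm
  obtain ⟨l, rfl⟩ : ∃ l, j = l * 4 + 2 := ⟨j / 4, by omega⟩
  rw [add_zsmul, mul_zsmul, ha4, zsmul_zero, zero_add] at hj
  rw [← hj]
  exact_mod_cast rfl

end FourTorsion

end QuadQCurve

open QuadQCurve

theorem mainTheorem6 {K : Type*} [Field K] [NumberField K] (hK : Module.finrank ℚ K = 2)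
    {L : Type*} [Field L] [DecidableEq L] [CharZero L] [Algebra K L] [IsAlgClosure K L]
    (E : WeierstrassCurve K) [E.IsElliptic] (hCM : QuadQCurve.IsNonCM L E)
    (d : ℕ) (hd : Odd d) (hQ : QuadQCurve.IsQCurveOfDegree L E d)
    (h4 : QuadQCurve.HasCyclicIsogeny L E 4) :
    ∃ (F : WeierstrassCurve K) (_ : F.IsElliptic), (F = E ∨ QuadQCurve.IsogenousOver L E F) ∧
      (QuadQCurve.CorrespondsToRationalPointPlus L F (4 * d) ∨
        QuadQCurve.CorrespondsToRationalPointPlus L F (16 * d) ∨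
        QuadQCurve.CorrespondsToRationalPoint L F (4 * d) d) := by
  have : IsAlgClosed L := IsAlgClosure.isAlgClosed K
  obtain ⟨σ, hσ, μ, hμ, hμd⟩ := hQ
  obtain ⟨E', hE', φ, hφ, hφ4⟩ := h4
  have := isElliptic_baseChange L E
  have := isElliptic_baseChange L E'
  have := isElliptic_baseChange L (E.map (σ : K →+* K))
  have := isElliptic_baseChange L (E'.map (σ : K →+* K))
  obtain ⟨τ₀, hτ₀⟩ := exists_actsAs (L := L) σ
  have hσσ := mul_self_eq_one_of_finrank_eq_two hK σ
  have hsplit := actsAs_one_or_actsAs (L := L) hK hσ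
  have hC := conjugates_baseChange (L := L) hσσ E
  have hC' := conjugates_baseChange (L := L) hσσ E'
  have hd0 : 0 < d := hd.pos
  have hd2 : d.Coprime 2 := hd.coprime_two_right
  obtain ⟨c, hc, hco⟩ := exists_zmultiples_eq_of_isAddCyclic hφ4.1
  rw [hφ4.2] at hco
  have hφc : φ c = 0 := (hc ▸ AddSubgroup.mem_zmultiples c : c ∈ φ.ker)
  have hφL : IsIsogeny L φ := hφ.of_algebra
  have hc₀o : addOrderOf (conjHom τ₀ (hC.swap hτ₀) c) = 4 := by
    rw [addOrderOf_injective _ (conjHom_injective _), hco]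
  -- The generator of the conjugate kernel is pulled back through μ to compare it with c on E
  -- itself.
  obtain ⟨e, hμe, heo⟩ := exists_four_torsion_lift hμ.surjective hd hμd.2 hc₀o
  set φ₀ := conjMap τ₀ (hC.swap hτ₀) (hC'.swap hτ₀) φ with hφ₀
  have hφ₀e : φ₀ (μ e) = 0 := by rw [hμe, hφ₀, conjMap_conjHom, hφc, map_zero]
  by_cases he : φ e = 0
  · refine ⟨E, inferInstance, Or.inl rfl, Or.inr (Or.inr ?_)⟩
    have hker : φ.ker = AddSubgroup.zmultiples e := by
      have : Finite φ.ker := hφL.finite_ker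
      refine (AddSubgroup.eq_of_le_of_card_ge (AddSubgroup.zmultiples_le_of_mem he) ?_).symm
      rw [Nat.card_zmultiples, heo, hφ4.2]
    obtain ⟨x, hxj, hx⟩ := exists_levelPair_of_map_ker_eq hC hC' hsplit hτ₀ hCM hd0 hμ hμd
      (m := 4) (by norm_num) (Nat.Coprime.pow_left 2 hd2.symm : Nat.Coprime (2 ^ 2) d) hφ hφ4 (by
        rw [ker_conjMap, hker, AddMonoidHom.map_zmultiples, hμe, ← hker, hc,
          AddMonoidHom.map_zmultiples])
    exact ⟨x, hx, Or.inl (by rw [hxj]; exact (E.map_j (algebraMap K L)).symm)⟩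
  refine ⟨E', hE', Or.inr ⟨φ, hφ⟩, ?_⟩
  have hE'j : (E'.baseChange L).j = algebraMap K L E'.j := E'.map_j (algebraMap K L)
  by_cases he2 : φ (2 • e) = 0
  · refine Or.inl ?_
    -- Here φ(e) has order 2 and 2c = 2e, so m = 2 suffices; halving e gives a point with φ(Q) of
    -- order 4.
    obtain ⟨Q, hQ⟩ := (isIsogeny_natCast (E.baseChange L) two_pos).surjective e
    have hQ : ((2 : ℕ) : ℤ) • Q = e := hQ
    have hcc := two_nsmul_eq_of_mem_zmultiples hco heo (hc ▸ he2)
    obtain ⟨x, hxj, hx⟩ := exists_levelPair_of_addOrderOf hC hC' hσσ hsplit hτ₀ hCM hd0 hμ hμd hφ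
      (by rw [hφ4.2]; exact Nat.Coprime.pow_right 2 hd2) two_pos (Nat.Coprime.pow_right 2 hd2)
      (by
        intro P hP
        rw [hc] at hP
        obtain ⟨z, rfl⟩ := AddSubgroup.mem_zmultiples_iff.mp hP
        rw [smul_comm, natCast_zsmul, hcc, map_zsmul, map_zsmul, map_nsmul, map_nsmul]
        change z • 2 • φ₀ (μ e) = 0
        rw [hφ₀e, nsmul_zero, zsmul_zero])
      (Q := Q) (by rw [hQ]; exact hφ₀e)
      (by
        have : Fact (Nat.Prime 2) := ⟨Nat.prime_two⟩
        rw [natCast_zsmul] at hQ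
        refine addOrderOf_eq_prime_pow (n := 1) ?_ ?_
        · rwa [pow_one, ← map_nsmul, hQ]
        · rw [← map_nsmul, show 2 ^ (1 + 1) = 2 * 2 from rfl, mul_nsmul', hQ, he2])
    exact ⟨x, hx, Or.inl (by rw [hxj, hE'j])⟩
  · refine Or.inr (Or.inl ?_)
    -- Here φ(e) has order 4. With m = 4 the kernel of φ is killed already by [4], and a quarter of
    -- e has image of order 16.
    obtain ⟨Q, hQ⟩ := (isIsogeny_natCast (E.baseChange L) four_pos).surjective e
    have hQ : ((4 : ℕ) : ℤ) • Q = e := hQ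
    obtain ⟨x, hxj, hx⟩ := exists_levelPair_of_addOrderOf hC hC' hσσ hsplit hτ₀ hCM hd0 hμ hμd hφ
      (by rw [hφ4.2]; exact Nat.Coprime.pow_right 2 hd2) four_pos
      (Nat.Coprime.pow_right 4 hd2 : d.Coprime (2 ^ 4))
      (by
        intro P hP
        rw [hc] at hP
        obtain ⟨z, rfl⟩ := AddSubgroup.mem_zmultiples_iff.mp hP
        rw [smul_comm, natCast_zsmul, ← hco, addOrderOf_nsmul_eq_zero, zsmul_zero, map_zero,
          map_zero])
      (Q := Q) (by rw [hQ]; exact hφ₀e)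
      (by
        have : Fact (Nat.Prime 2) := ⟨Nat.prime_two⟩
        rw [natCast_zsmul] at hQ
        refine addOrderOf_eq_prime_pow (p := 2) (n := 3) ?_ ?_
        · rwa [← map_nsmul, show 2 ^ 3 = 2 * 4 from rfl, mul_nsmul', hQ]
        · rw [← map_nsmul, show 2 ^ (3 + 1) = 4 * 4 from rfl, mul_nsmul', hQ, ← heo,
            addOrderOf_nsmul_eq_zero, map_zero])
    exact ⟨x, hx, Or.inl (by rw [hxj, hE'j])⟩
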